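/- Let $(\mathcal X,\mathfrak S,\mu)$ be a $\sigma$-finite measure space with an increasing sequence of $\sigma$-algebras $\mathfrak S_n\subset\mathfrak S_{n+1}\subset\mathfrak S$, $n\in\mathbb Z$, each of which is atomic: there is a countable disjoint collection $\mathscr D_n\subset\mathfrak S_n$ of sets of positive finite measure (atoms) such that every $A\in\mathfrak S_n$ is a union of members of $\mathscr D_n$. Put $\mathscr D=\bigcup_{n}\mathscr D_n$, write $|A|=\mu(A)$, $dx=d\mu(x)$, $\langle g\rangle_I=|I|^{-1}\int_I g\,dx$, and let $Mg(x)=\sup\{\langle |g|\rangle_I: I\in\mathscr D,\ x\in I\}$ be the martingale maximal function. A family $\mathcal Q\subset\mathscr D$ is called sparse if $\bigl|\bigcup_{I\in\mathcal Q,\,I\subsetneq I_0}I\bigr|\le\frac12|I_0|$ for every $I_0\in\mathcal Q$; the corresponding sparse (Lerner type) operator is $$T_{\mathcal Q}\,g=\sum_{I\in\mathcal Q}\langle g\rangle_I\,\mathbf 1_I .$$ Let $\alpha:[1,\infty)\to(0,\infty)$ be such that $t\mapsto t\alpha(t)$ is non-decreasing and $\int_1^\infty\frac{dt}{t\alpha(t)}<\infty$.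 Let $u,v\ge0$ be weights on $\mathcal X$, that is, measurable functions integrable over each $I\in\mathscr D$; write $\mathbf u_I=\langle u\rangle_I$, $\mathbf u_I^*=\langle M(\mathbf 1_Iu)\rangle_I$, and similarly $\mathbf v_I$, $\mathbf v_I^*$. Assume the separated (one-sided) entropy bump conditions $$\sup_{I\in\mathscr D}\alpha\bigl(\mathbf u_I^*/\mathbf u_I\bigr)^2\,\mathbf u_I^*\,\mathbf v_I<\infty,\qquad \sup_{I\in\mathscr D}\alpha\bigl(\mathbf v_I^*/\mathbf v_I\bigr)^2\,\mathbf v_I^*\,\mathbf u_I<\infty,$$ where both expressions are taken to be $0$ if $\mathbf u_I=0$ or $\mathbf v_I=0$, and otherwise to be $+\infty$ if the entropy average $\mathbf u_I^*$, respectively $\mathbf v_I^*$, that occurs in them is infinite. Then there is a constant $C<\infty$ such that for every sparse family $\mathcal Q\subset\mathscr D$, with $T=T_{\mathcal Q}$, and for every (real or complex valued) $f\in L^2(u)$ the series defining $T(fu)$ converges absolutely $v\,dx$-almost everywhere and $$\int_{\mathcal X}|T(fu)|^2\,v\,dx\le C\int_{\mathcal X}|f|^2\,u\,dx .$$ -/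

import Mathlib

open MeasureTheory Set
open scoped ENNReal NNReal

namespace EntropyBump

variable {X : Type*} [m0 : MeasurableSpace X]

/-- A filtration `(𝔖ₙ)`, `n ∈ ℤ`, of atomic σ-algebras on the measure space `(X, μ)`: for each `n`
there is a countable disjoint collection `atoms n` of `𝔖ₙ`-measurable sets of positive (and finite)
measure such that every set of `𝔖ₙ` is a union of members of `atoms n`. The same set may be an atom
of several generations. -/
structure AtomicFiltration (μ : Measure X) where
  /-- the increasing family of σ-algebras -/
  filtration : Filtration ℤ m0
  /-- the atoms of generation `n` -/
  atoms : ℤ → Set (Set X)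
  countable_atoms : ∀ n, (atoms n).Countable
  pairwiseDisjoint_atoms : ∀ n, (atoms n).PairwiseDisjoint id
  measurableSet_atom : ∀ n, ∀ I ∈ atoms n, MeasurableSet[filtration n] I
  measure_atom_pos : ∀ n, ∀ I ∈ atoms n, 0 < μ I
  measure_atom_lt_top : ∀ n, ∀ I ∈ atoms n, μ I < ∞
  exists_eq_sUnion : ∀ n, ∀ A : Set X, MeasurableSet[filtration n] A →
    ∃ S ⊆ atoms n, A = ⋃₀ S

namespace AtomicFiltration

variable {μ : Measure X} (𝓕 : AtomicFiltration μ)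

/-- The collection `𝒟` of the atoms of all generations. -/
def lattice : Set (Set X) := ⋃ n, 𝓕.atoms n

/-- The martingale maximal function `M w (x) = sup {⟨w⟩_I : I ∈ 𝒟, x ∈ I}` of a nonnegative
function `w`. -/
noncomputable def maximal (w : X → ℝ≥0∞) (x : X) : ℝ≥0∞ :=
  ⨆ I ∈ 𝓕.lattice, ⨆ _ : x ∈ I, ⨍⁻ y in I, w y ∂μ

/-- The average `u_I = ⟨u⟩_I` of a weight. -/
noncomputable def avg (_𝓕 : AtomicFiltration μ) (u : X → ℝ≥0) (I : Set X) : ℝ≥0∞ :=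
  ⨍⁻ x in I, (u x : ℝ≥0∞) ∂μ

/-- The entropy average `u*_I = ⟨M(𝟏_I u)⟩_I` of a weight. -/
noncomputable def entropyAvg (u : X → ℝ≥0) (I : Set X) : ℝ≥0∞ :=
  ⨍⁻ x in I, 𝓕.maximal (I.indicator fun y => (u y : ℝ≥0∞)) x ∂μ

/-- The one-sided entropy bump condition `sup_{I ∈ 𝒟} α(u*_I / u_I)² u*_I v_I < ∞`.
The expression counts as `0` where `u_I = 0` or `v_I = 0`, and as `∞` where `u_I, v_I > 0` and
`u*_I = ∞`. -/
def OneSidedBump (α : ℝ → ℝ) (u v : X → ℝ≥0) : Prop :=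
  ∃ A : ℝ, ∀ I ∈ 𝓕.lattice, 𝓕.avg u I ≠ 0 → 𝓕.avg v I ≠ 0 →
    𝓕.entropyAvg u I ≠ ∞ ∧
      α ((𝓕.entropyAvg u I).toReal / (𝓕.avg u I).toReal) ^ 2 *
        (𝓕.entropyAvg u I).toReal * (𝓕.avg v I).toReal ≤ A

/-- A family `Q ⊆ 𝒟` is sparse if for each `I₀ ∈ Q` the union of all `I ∈ Q` properly contained in
`I₀` has measure at most `|I₀| / 2`. -/
structure IsSparse (Q : Set (Set X)) : Prop where
  subset_lattice : Q ⊆ 𝓕.lattice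
  measure_le : ∀ I₀ ∈ Q, μ (⋃₀ {I | I ∈ Q ∧ I ⊂ I₀}) ≤ μ I₀ / 2

end AtomicFiltration

variable {𝕜 : Type*} [RCLike 𝕜]

/-- The term `⟨g⟩_I 𝟏_I` of a sparse operator. -/
noncomputable def sparseTerm (μ : Measure X) (g : X → 𝕜) (I : Set X) : X → 𝕜 :=
  I.indicator fun _ => ⨍ y in I, g y ∂μ

/-- The sparse (Lerner type) operator `T_Q g = ∑_{I ∈ Q} ⟨g⟩_I 𝟏_I`. -/
noncomputable def sparseOp (μ : Measure X) (Q : Set (Set X)) (g : X → 𝕜) (x : X) : 𝕜 :=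
  ∑' I : Q, sparseTerm μ g (I : Set X) x

end EntropyBump

/-!
Write `σ = u dx` and `ω = v dx`. The bilinear form of the sparse operator is split according to
which of `a_J² σ(J)` and `b_J² ω(J)` is larger, where `a_J` and `b_J` are the averages of `F` and
`G` with respect to `σ` and `ω`. By symmetry let the first one be larger. Decompose the family into
coronas over stopping sets chosen from the `σ`-averages of `F`. On one corona these averages are
comparable, so Cauchy–Schwarz and the testing condition for `σ` apply, and what remains of `G` is
orthogonal over the coronas up to a part supported on stopping sets, where the averages of `G` are
dominated by those of `F`; the Carleson embedding theorem sums up both. Hence the testing condition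
for `σ` alone is enough.

Testing costs a factor `(u*_I / u_I)^{1/2}`. On the class where this ratio is about `2ⁿ`, the bump
condition bounds the testing constant by a multiple of `1 / α(2ⁿ)`, and these numbers are summable
by Cauchy condensation of `∫ dt / (t α(t))`.

Since domination is not invariant under scaling `F` and `G` separately, the estimate for the form is
the additive one by `‖F‖² + ‖G‖²`. Taking for `G` the multiples of `T(F dσ)` and optimising the
factor turns it into the norm inequality.
-/

namespace EntropyBump

section ENNReal

lemma two_mul_mul_le_inv_mul_sq_add_mul_sq (t x y : ℝ≥0∞) :
    2 * (x * y) ≤ t⁻¹ * x ^ 2 + t * y ^ 2 := by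
  rcases eq_or_ne x 0 with rfl | hx
  · simp
  rcases eq_or_ne y 0 with rfl | hy
  · simp
  rcases eq_or_ne t 0 with rfl | ht
  · simp [hx]
  rcases eq_or_ne t ∞ with rfl | ht'
  · simp [hy]
  lift t to ℝ≥0 using ht'
  have htpos : t ≠ 0 := mod_cast ht
  rcases eq_or_ne x ∞ with rfl | hx'
  · simp [ENNReal.top_pow, ENNReal.mul_top]
  rcases eq_or_ne y ∞ with rfl | hy'
  · simp [ENNReal.top_pow, ENNReal.mul_top ht]
  lift x to ℝ≥0 using hx'
  lift y to ℝ≥0 using hy'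
  rw [← ENNReal.coe_inv htpos]
  norm_cast
  rw [← NNReal.coe_le_coe]
  push_cast
  have : (0 : ℝ) < t := by positivity
  have hsq : ((t : ℝ)⁻¹ * x ^ 2 + t * y ^ 2) - 2 * (x * y) = (t : ℝ)⁻¹ * (x - t * y) ^ 2 := by
    field_simp
    ring
  have hnonneg : 0 ≤ (t : ℝ)⁻¹ * (x - t * y) ^ 2 := by positivity
  linarith

lemma le_two_mul_of_le_add_half {x y : ℝ≥0∞} (hx : x ≠ ∞) (h : x ≤ y + x / 2) : x ≤ 2 * y := by
  have hhalf : x / 2 ≤ y := by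
    rw [← ENNReal.add_le_add_iff_right (ENNReal.div_ne_top hx two_ne_zero), ENNReal.add_halves]
    exact h
  calc x = x / 2 + x / 2 := (ENNReal.add_halves x).symm
    _ ≤ y + y := add_le_add hhalf hhalf
    _ = 2 * y := (two_mul y).symm

/- The scaling `s` optimises the hypothesis at `s = 1 / (2 * C)`. -/
lemma le_four_mul_sq_mul_of_forall_mul_le {x y : ℝ≥0∞} {C : ℝ≥0} (hy : y ≠ ∞)
    (h : ∀ s : ℝ≥0, s * y ≤ C * (x + s ^ 2 * y)) : y ≤ 4 * C ^ 2 * x := by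
  rcases eq_or_ne C 0 with rfl | hC
  · simpa using h 1
  rcases eq_or_ne x ∞ with rfl | hx
  · simp [ENNReal.mul_top, hC]
  lift y to ℝ≥0 using hy
  lift x to ℝ≥0 using hx
  have hs := h (2 * C)⁻¹
  norm_cast at hs ⊢
  rw [← NNReal.coe_le_coe] at hs ⊢
  push_cast at hs ⊢
  have hCpos : (0 : ℝ) < C := by positivity
  field_simp at hs
  linarith

lemma sum_two_zpow_le (T : Finset ℤ) :
    ∀ n : ℤ, (∀ j ∈ T, j ≤ n) → ∑ j ∈ T, (2 : ℝ≥0∞) ^ j ≤ 2 ^ (n + 1) := by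
  induction T using Finset.induction_on_max with
  | empty => simp
  | insert m s hm ih =>
    intro n hn
    have hms : m ∉ s := fun h => lt_irrefl _ (hm m h)
    have hmn := hn m (Finset.mem_insert_self _ _)
    rw [Finset.sum_insert hms]
    calc (2 : ℝ≥0∞) ^ m + ∑ j ∈ s, 2 ^ j ≤ 2 ^ m + 2 ^ m := by
          gcongr
          simpa using ih (m - 1) fun j hj => by have := hm j hj; omega
      _ = 2 ^ (m + 1) := by
          rw [ENNReal.zpow_add two_ne_zero ENNReal.ofNat_ne_top, zpow_one, mul_two]
      _ ≤ 2 ^ (n + 1) := ENNReal.zpow_le_of_le one_le_two (by omega)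

/- The terms grow geometrically, so the sum is comparable to its largest term. -/
lemma sq_sum_le_of_injOn {ι : Type*} (Y : Finset ι) (k : ι → ℤ) (hk : Set.InjOn k Y)
    (a : ι → ℝ≥0∞) (hl : ∀ i ∈ Y, 2 ^ k i ≤ a i) (hu : ∀ i ∈ Y, a i ≤ 2 ^ (k i + 1)) :
    (∑ i ∈ Y, a i) ^ 2 ≤ 16 * ∑ i ∈ Y, a i ^ 2 := by
  rcases Y.eq_empty_or_nonempty with rfl | hne
  · simp
  obtain ⟨i₀, hi₀, hmax⟩ := Y.exists_max_image k hne
  have zpow_succ (n : ℤ) : (2 : ℝ≥0∞) ^ (n + 1) = 2 * 2 ^ n := by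
    rw [ENNReal.zpow_add two_ne_zero ENNReal.ofNat_ne_top, zpow_one, mul_comm]
  have hsum : ∑ i ∈ Y, a i ≤ 4 * a i₀ := by
    calc ∑ i ∈ Y, a i ≤ ∑ i ∈ Y, 2 * (2 : ℝ≥0∞) ^ k i :=
          Finset.sum_le_sum fun i hi => (hu i hi).trans_eq (zpow_succ _)
      _ = 2 * ∑ j ∈ Y.image k, (2 : ℝ≥0∞) ^ j := by
          rw [Finset.sum_image hk, Finset.mul_sum]
      _ ≤ 2 * 2 ^ (k i₀ + 1) := by
          gcongr
          exact sum_two_zpow_le _ _ (by simpa using hmax)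
      _ = 4 * 2 ^ k i₀ := by
          rw [zpow_succ]
          ring
      _ ≤ 4 * a i₀ := by
          gcongr
          exact hl _ hi₀
  calc (∑ i ∈ Y, a i) ^ 2 ≤ (4 * a i₀) ^ 2 := by gcongr
    _ = 16 * a i₀ ^ 2 := by ring
    _ ≤ 16 * ∑ i ∈ Y, a i ^ 2 := by
      gcongr
      exact Finset.single_le_sum (f := fun i => a i ^ 2) (fun _ _ => zero_le) hi₀

end ENNReal

section Laminar

variable {X : Type*}

/-- A laminar family of sets: any two members are nested or disjoint. -/
def IsLaminar (R : Set (Set X)) : Prop :=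
  ∀ I ∈ R, ∀ J ∈ R, I ⊆ J ∨ J ⊆ I ∨ Disjoint I J

lemma IsLaminar.mono {R R' : Set (Set X)} (h : IsLaminar R) (hR : R' ⊆ R) : IsLaminar R' :=
  fun I hI J hJ => h I (hR hI) J (hR hJ)

lemma IsLaminar.ssubset_or_ssubset_or_disjoint {R : Set (Set X)} (h : IsLaminar R) {I J : Set X}
    (hI : I ∈ R) (hJ : J ∈ R) (hne : I ≠ J) : I ⊂ J ∨ J ⊂ I ∨ Disjoint I J :=
  (h I hI J hJ).imp (·.ssubset_of_ne hne) (.imp_left (·.ssubset_of_ne hne.symm))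

open Classical in
lemma IsLaminar.sq_sum_indicator_le {R : Finset (Set X)} (hR : IsLaminar (R : Set (Set X)))
    (w : Set X → ℝ≥0∞) (x : X) :
    (∑ J ∈ R, J.indicator (fun _ => w J) x) ^ 2 ≤
      2 * ∑ J ∈ R, w J * ∑ K ∈ R with K ⊆ J, K.indicator (fun _ => w K) x := by
  set nested : Set X → Set X → ℝ≥0∞ := fun J K =>
    if K ⊆ J then w J * K.indicator (fun _ => w K) x else 0 with nested_def
  have mul_le : ∀ J ∈ R, ∀ K ∈ R,
      J.indicator (fun _ => w J) x * K.indicator (fun _ => w K) x ≤ nested J K + nested K J := by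
    intro J hJ K hK
    by_cases hxJ : x ∈ J
    · by_cases hxK : x ∈ K
      · rcases hR J hJ K hK with h | h | h
        · refine le_add_left ?_
          simp [nested_def, h, hxJ, hxK, mul_comm]
        · refine le_add_right ?_
          simp [nested_def, h, hxJ, hxK]
        · exact absurd hxK (Set.disjoint_left.1 h hxJ)
      · simp [hxK]
    · simp [hxJ]
  calc (∑ J ∈ R, J.indicator (fun _ => w J) x) ^ 2
      = ∑ J ∈ R, ∑ K ∈ R, J.indicator (fun _ => w J) x * K.indicator (fun _ => w K) x := by
        rw [sq, Finset.sum_mul_sum]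
    _ ≤ ∑ J ∈ R, ∑ K ∈ R, (nested J K + nested K J) :=
        Finset.sum_le_sum fun J hJ => Finset.sum_le_sum fun K hK => mul_le J hJ K hK
    _ = 2 * ∑ J ∈ R, ∑ K ∈ R, nested J K := by
        simp_rw [Finset.sum_add_distrib]
        rw [Finset.sum_comm (f := fun J K => nested K J), two_mul]
    _ = 2 * ∑ J ∈ R, w J * ∑ K ∈ R with K ⊆ J, K.indicator (fun _ => w K) x := by
        congr 1
        exact Finset.sum_congr rfl fun J _ => by rw [Finset.mul_sum, Finset.sum_filter]

/-- The part of `J` outside the members of `Q` that it properly contains. -/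
def exclusivePart (Q : Set (Set X)) (J : Set X) : Set X :=
  J \ ⋃₀ {K | K ∈ Q ∧ K ⊂ J}

lemma exclusivePart_subset {Q : Set (Set X)} {J : Set X} : exclusivePart Q J ⊆ J :=
  Set.sdiff_subset

lemma IsLaminar.pairwiseDisjoint_exclusivePart {Q : Set (Set X)} (hQ : IsLaminar Q) :
    Q.PairwiseDisjoint (exclusivePart Q) := by
  intro J hJ K hK hne
  rcases hQ.ssubset_or_ssubset_or_disjoint hJ hK hne with h | h | h
  · exact Set.disjoint_left.2 fun x hxJ hxK => hxK.2 ⟨J, ⟨hJ, h⟩, exclusivePart_subset hxJ⟩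
  · exact Set.disjoint_left.2 fun x hxJ hxK => hxJ.2 ⟨K, ⟨hK, h⟩, exclusivePart_subset hxK⟩
  · exact h.mono exclusivePart_subset exclusivePart_subset

end Laminar

section Stopping

variable {X : Type*}

section Definitions

variable (R : Finset (Set X)) (k : Set X → ℤ)

open Classical in
/-- The stopping sets of the family `R` for the level function `k`: the members whose level exceeds
the level of each of their strict ancestors in `R`. -/
noncomputable def stoppingSets : Finset (Set X) :=
  {S ∈ R | ∀ I ∈ R, S ⊂ I → k I < k S}

open Classical in
/-- The stopping children of `S`: the maximal members of `R` inside `S` whose level exceeds that of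
`S`. -/
noncomputable def stoppingChildren (S : Set X) : Finset (Set X) :=
  {J ∈ R | J ⊆ S ∧ k S < k J ∧ ∀ I ∈ R, J ⊂ I → k I ≤ k S}

open Classical in
/-- The corona of `S`: the members of `R` inside `S` that have the level of `S`. -/
noncomputable def corona (S : Set X) : Finset (Set X) :=
  {J ∈ R | J ⊆ S ∧ k J = k S}

/-- The part of `S` outside its stopping children. -/
def stoppingCore (S : Set X) : Set X :=
  S \ ⋃ J ∈ stoppingChildren R k S, J

/-- The level function `k` records the dyadic size of `a` along the family `R`: the levels increase
towards smaller sets, `a J` never exceeds the dyadic interval of the level of `J`, and at the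
stopping sets `a` lies in that interval. -/
structure IsLevel (a : Set X → ℝ≥0∞) : Prop where
  antitoneOn : AntitoneOn k (R : Set (Set X))
  le_zpow : ∀ J ∈ R, a J ≤ 2 ^ (k J + 1)
  zpow_le : ∀ S ∈ stoppingSets R k, 2 ^ k S ≤ a S

end Definitions

variable {R : Finset (Set X)} {k : Set X → ℤ} {S T J : Set X}

lemma mem_stoppingSets : S ∈ stoppingSets R k ↔ S ∈ R ∧ ∀ I ∈ R, S ⊂ I → k I < k S := by
  simp [stoppingSets]

lemma mem_stoppingChildren : J ∈ stoppingChildren R k S ↔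
    J ∈ R ∧ J ⊆ S ∧ k S < k J ∧ ∀ I ∈ R, J ⊂ I → k I ≤ k S := by
  simp [stoppingChildren]

lemma mem_corona : J ∈ corona R k S ↔ J ∈ R ∧ J ⊆ S ∧ k J = k S := by
  simp [corona]

lemma stoppingSets_subset : stoppingSets R k ⊆ R :=
  fun _ h => (mem_stoppingSets.1 h).1

lemma stoppingChildren_subset : stoppingChildren R k S ⊆ R :=
  fun _ h => (mem_stoppingChildren.1 h).1

lemma corona_subset : corona R k S ⊆ R :=
  fun _ h => (mem_corona.1 h).1

lemma stoppingCore_subset : stoppingCore R k S ⊆ S :=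
  Set.sdiff_subset

lemma stoppingChildren_subset_stoppingSets : stoppingChildren R k S ⊆ stoppingSets R k := by
  intro J hJ
  obtain ⟨hJR, -, hlt, hmax⟩ := mem_stoppingChildren.1 hJ
  exact mem_stoppingSets.2 ⟨hJR, fun I hI hJI => (hmax I hI hJI).trans_lt hlt⟩

lemma exists_mem_corona (hk : AntitoneOn k (R : Set (Set X))) (hJ : J ∈ R) :
    ∃ S ∈ stoppingSets R k, J ∈ corona R k S := by
  classical
  have hne : {I ∈ R | J ⊆ I ∧ k I = k J}.Nonempty := ⟨J, by simp [hJ]⟩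
  obtain ⟨S, hS, hmax⟩ := Finset.exists_maximal hne
  obtain ⟨hSR, hJS, hkS⟩ := Finset.mem_filter.1 hS
  refine ⟨S, mem_stoppingSets.2 ⟨hSR, fun I hI hSI => ?_⟩, mem_corona.2 ⟨hJ, hJS, hkS.symm⟩⟩
  refine lt_of_le_of_ne (hk hSR hI hSI.subset) fun h => hSI.2 ?_
  exact hmax (Finset.mem_filter.2 ⟨hI, hJS.trans hSI.subset, h.trans hkS⟩) hSI.subset

lemma sum_le_sum_sum_corona (hk : AntitoneOn k (R : Set (Set X))) (f : Set X → ℝ≥0∞) :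
    ∑ J ∈ R, f J ≤ ∑ S ∈ stoppingSets R k, ∑ J ∈ corona R k S, f J := by
  classical
  simp_rw [corona, Finset.sum_filter]
  rw [Finset.sum_comm]
  refine Finset.sum_le_sum fun J hJ => ?_
  obtain ⟨S, hS, hJS⟩ := exists_mem_corona hk hJ
  rw [← Finset.sum_filter]
  exact Finset.single_le_sum (f := fun _ => f J) (fun _ _ => zero_le)
    (Finset.mem_filter.2 ⟨hS, (mem_corona.1 hJS).2⟩)

lemma exists_mem_stoppingChildren (hR : IsLaminar (R : Set (Set X)))
    (hk : AntitoneOn k (R : Set (Set X))) (hS : S ∈ R) (hJ : J ∈ R) (hne : J.Nonempty)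
    (hJS : J ⊆ S) (hlt : k S < k J) : ∃ T ∈ stoppingChildren R k S, J ⊆ T := by
  classical
  have hne' : {I ∈ R | J ⊆ I ∧ I ⊆ S ∧ k S < k I}.Nonempty := ⟨J, by simp [hJ, hJS, hlt]⟩
  obtain ⟨T, hT, hmax⟩ := Finset.exists_maximal hne'
  obtain ⟨hTR, hJT, hTS, hkT⟩ := Finset.mem_filter.1 hT
  refine ⟨T, mem_stoppingChildren.2 ⟨hTR, hTS, hkT, fun I hI hTI => ?_⟩, hJT⟩
  rcases hR I hI S hS with h | h | h
  · by_contra! hc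
    exact hTI.2 (hmax (Finset.mem_filter.2 ⟨hI, hJT.trans hTI.subset, h, hc⟩) hTI.subset)
  · exact hk hS hI h
  · obtain ⟨x, hx⟩ := hne
    exact absurd (hJS hx) (Set.disjoint_left.1 h (hTI.subset (hJT hx)))

lemma pairwiseDisjoint_stoppingChildren_id (hR : IsLaminar (R : Set (Set X))) (S : Set X) :
    (stoppingChildren R k S : Set (Set X)).PairwiseDisjoint id := by
  intro J hJ K hK hne
  obtain ⟨hJR, -, hJk, hJmax⟩ := mem_stoppingChildren.1 hJ
  obtain ⟨hKR, -, hKk, hKmax⟩ := mem_stoppingChildren.1 hK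
  rcases hR.ssubset_or_ssubset_or_disjoint hJR hKR hne with h | h | h
  · exact absurd (hJmax K hKR h) (not_le.2 hKk)
  · exact absurd (hKmax J hJR h) (not_le.2 hJk)
  · exact h

lemma disjoint_stoppingChildren_of_ssubset (hS : S ∈ R) (hT : T ∈ stoppingSets R k)
    (hTS : T ⊂ S) : Disjoint (stoppingChildren R k S) (stoppingChildren R k T) := by
  refine Finset.disjoint_left.2 fun J hJS hJT => ?_
  obtain ⟨hTR, hTmax⟩ := mem_stoppingSets.1 hT
  obtain ⟨-, -, -, hJmax⟩ := mem_stoppingChildren.1 hJS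
  obtain ⟨-, hJT', hTJ, -⟩ := mem_stoppingChildren.1 hJT
  have hkST := hTmax S hS hTS
  have hkTS := hJmax T hTR (hJT'.ssubset_of_ne fun h => by simp [h] at hTJ)
  omega

lemma pairwiseDisjoint_stoppingChildren (hR : IsLaminar (R : Set (Set X)))
    (hne : ∀ J ∈ R, J.Nonempty) :
    (stoppingSets R k : Set (Set X)).PairwiseDisjoint (stoppingChildren R k) := by
  intro S hS T hT hST
  have hSR := stoppingSets_subset hS
  have hTR := stoppingSets_subset hT
  rcases hR.ssubset_or_ssubset_or_disjoint hSR hTR hST with h | h | h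
  · exact (disjoint_stoppingChildren_of_ssubset hTR hS h).symm
  · exact disjoint_stoppingChildren_of_ssubset hSR hT h
  · refine Finset.disjoint_left.2 fun J hJS hJT => ?_
    obtain ⟨hJR, hJS', -⟩ := mem_stoppingChildren.1 hJS
    obtain ⟨-, hJT', -⟩ := mem_stoppingChildren.1 hJT
    obtain ⟨x, hx⟩ := hne J hJR
    exact Set.disjoint_left.1 h (hJS' hx) (hJT' hx)

lemma disjoint_stoppingCore_of_ssubset (hR : IsLaminar (R : Set (Set X)))
    (hne : ∀ J ∈ R, J.Nonempty) (hk : AntitoneOn k (R : Set (Set X))) (hS : S ∈ R)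
    (hT : T ∈ stoppingSets R k) (hTS : T ⊂ S) : Disjoint (stoppingCore R k S) T := by
  obtain ⟨hTR, hTmax⟩ := mem_stoppingSets.1 hT
  obtain ⟨K, hK, hTK⟩ :=
    exists_mem_stoppingChildren hR hk hS hTR (hne T hTR) hTS.subset (hTmax S hS hTS)
  exact Set.disjoint_left.2 fun x hx hxT => hx.2 (Set.mem_biUnion hK (hTK hxT))

lemma pairwiseDisjoint_stoppingCore (hR : IsLaminar (R : Set (Set X)))
    (hne : ∀ J ∈ R, J.Nonempty) (hk : AntitoneOn k (R : Set (Set X))) :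
    (stoppingSets R k : Set (Set X)).PairwiseDisjoint (stoppingCore R k) := by
  intro S hS T hT hST
  have hSR := stoppingSets_subset hS
  have hTR := stoppingSets_subset hT
  rcases hR.ssubset_or_ssubset_or_disjoint hSR hTR hST with h | h | h
  · exact ((disjoint_stoppingCore_of_ssubset hR hne hk hTR hS h).mono_right
      stoppingCore_subset).symm
  · exact (disjoint_stoppingCore_of_ssubset hR hne hk hSR hT h).mono_right stoppingCore_subset
  · exact h.mono stoppingCore_subset stoppingCore_subset

open Classical in
lemma injOn_level_stoppingSets (hR : IsLaminar (R : Set (Set X))) (x : X) :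
    Set.InjOn k ({S ∈ stoppingSets R k | x ∈ S} : Finset (Set X)) := by
  intro S hS T hT hkST
  obtain ⟨hS, hxS⟩ := Finset.mem_filter.1 hS
  obtain ⟨hT, hxT⟩ := Finset.mem_filter.1 hT
  obtain ⟨hSR, hSmax⟩ := mem_stoppingSets.1 hS
  obtain ⟨hTR, hTmax⟩ := mem_stoppingSets.1 hT
  by_contra hne
  rcases hR.ssubset_or_ssubset_or_disjoint hSR hTR hne with h | h | h
  · exact (hSmax T hTR h).ne' hkST
  · exact (hTmax S hSR h).ne hkST
  · exact Set.disjoint_left.1 h hxS hxT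

/- The level of `J` is the dyadic size of the largest value of `a` at the ancestors of `J`. -/
lemma exists_isLevel {a : Set X → ℝ≥0∞} (ha0 : ∀ J ∈ R, a J ≠ 0) (haT : ∀ J ∈ R, a J ≠ ∞) :
    ∃ k, IsLevel R k a := by
  classical
  let A (J : Set X) : ℝ≥0∞ := {I ∈ R | J ⊆ I}.sup a
  have le_A : ∀ I ∈ R, ∀ J, J ⊆ I → a I ≤ A J := fun I hI J hJI =>
    Finset.le_sup (Finset.mem_filter.2 ⟨hI, hJI⟩)
  have A_eq : ∀ J ∈ R, ∃ I ∈ R, J ⊆ I ∧ A J = a I := fun J hJ => by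
    obtain ⟨I, hI, h⟩ := Finset.exists_mem_eq_sup {I ∈ R | J ⊆ I} ⟨J, by simp [hJ]⟩ a
    exact ⟨I, (Finset.mem_filter.1 hI).1, (Finset.mem_filter.1 hI).2, h⟩
  have exists_zpow : ∀ J, ∃ n : ℤ, J ∈ R → A J ∈ Set.Ico ((2 : ℝ≥0∞) ^ n) (2 ^ (n + 1)) := by
    intro J
    by_cases hJ : J ∈ R
    · obtain ⟨I, hI, -, h⟩ := A_eq J hJ
      obtain ⟨n, hn⟩ := ENNReal.exists_mem_Ico_zpow (h ▸ ha0 I hI) (h ▸ haT I hI)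
        (y := 2) ENNReal.one_lt_two ENNReal.ofNat_ne_top
      exact ⟨n, fun _ => hn⟩
    · exact ⟨0, fun h => absurd h hJ⟩
  choose k hk using exists_zpow
  have level_le : ∀ I ∈ R, ∀ J ∈ R, A J ≤ A I → k J ≤ k I := fun I hI J hJ h => by
    by_contra! hlt
    have hzpow : (2 : ℝ≥0∞) ^ (k I + 1) ≤ 2 ^ k J := ENNReal.zpow_le_of_le one_le_two hlt
    exact (hzpow.trans ((hk J hJ).1.trans h)).not_gt (hk I hI).2
  refine ⟨k, fun I hI J hJ hIJ => ?_, fun J hJ => (le_A J hJ J le_rfl).trans (hk J hJ).2.le,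
    fun S hS => ?_⟩
  · obtain ⟨K, hK, hJK, h⟩ := A_eq J hJ
    exact level_le I hI J hJ (h.trans_le (le_A K hK I (hIJ.trans hJK)))
  · obtain ⟨hSR, hSmax⟩ := mem_stoppingSets.1 hS
    obtain ⟨I, hI, hSI, h⟩ := A_eq S hSR
    rcases eq_or_ne S I with rfl | hne
    · exact (hk S hSR).1.trans_eq h
    · have hlevel := level_le I hI S hSR (h.trans_le (le_A I hI I le_rfl))
      exact absurd (hSmax I hI (hSI.ssubset_of_ne hne)) hlevel.not_gt

lemma IsLevel.sq_sum_indicator_le {a : Set X → ℝ≥0∞} (hR : IsLaminar (R : Set (Set X)))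
    (hk : IsLevel R k a) (x : X) :
    (∑ S ∈ stoppingSets R k, S.indicator (fun _ => a S) x) ^ 2 ≤
      16 * ∑ S ∈ stoppingSets R k, S.indicator (fun _ => a S ^ 2) x := by
  classical
  have hsum := sq_sum_le_of_injOn {S ∈ stoppingSets R k | x ∈ S} k (injOn_level_stoppingSets hR x) a
    (fun S hS => hk.zpow_le S (Finset.mem_filter.1 hS).1)
    (fun S hS => hk.le_zpow S (stoppingSets_subset (Finset.mem_filter.1 hS).1))
  simpa only [Finset.sum_filter, Set.indicator_apply] using hsum

lemma IsLevel.le_two_mul {a : Set X → ℝ≥0∞} (hk : IsLevel R k a) (hS : S ∈ stoppingSets R k)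
    (hJ : J ∈ corona R k S) : a J ≤ 2 * a S := by
  obtain ⟨hJR, -, hkJ⟩ := mem_corona.1 hJ
  calc a J ≤ 2 ^ (k S + 1) := hkJ ▸ hk.le_zpow J hJR
    _ = 2 * 2 ^ k S := by
      rw [ENNReal.zpow_add two_ne_zero ENNReal.ofNat_ne_top, zpow_one, mul_comm]
    _ ≤ 2 * a S := by
      gcongr
      exact hk.zpow_le S hS

end Stopping

section Embedding

variable {X : Type*} [MeasurableSpace X] {ν : Measure X}

lemma measure_ne_zero_of_setLAverage_ne_zero {F : X → ℝ≥0∞} {J : Set X}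
    (h : ⨍⁻ x in J, F x ∂ν ≠ 0) : ν J ≠ 0 := by
  rintro hJ
  simp [Measure.restrict_eq_zero.2 hJ] at h

lemma measure_ne_top_of_setLAverage_ne_zero {F : X → ℝ≥0∞} {J : Set X}
    (h : ⨍⁻ x in J, F x ∂ν ≠ 0) : ν J ≠ ∞ := by
  rintro hJ
  simp [setLAverage_eq, hJ] at h

lemma two_mul_lintegral_mul_le {f g : X → ℝ≥0∞} (hf : AEMeasurable f ν) (hg : AEMeasurable g ν)
    (t : ℝ≥0∞) :
    2 * ∫⁻ x, f x * g x ∂ν ≤ t⁻¹ * ∫⁻ x, f x ^ 2 ∂ν + t * ∫⁻ x, g x ^ 2 ∂ν := by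
  rw [← lintegral_const_mul'' _ (hf.fun_mul hg), ← lintegral_const_mul'' _ (hf.pow_const 2),
    ← lintegral_const_mul'' _ (hg.pow_const 2), ← lintegral_add_right' _ (by fun_prop)]
  exact lintegral_mono fun x => two_mul_mul_le_inv_mul_sq_add_mul_sq t (f x) (g x)

variable {R : Finset (Set X)}

lemma measurable_sum_indicator (hm : ∀ J ∈ R, MeasurableSet J) (w : Set X → ℝ≥0∞) :
    Measurable fun x => ∑ J ∈ R, J.indicator (fun _ => w J) x :=
  Finset.measurable_sum _ fun J hJ => measurable_const.indicator (hm J hJ)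

lemma lintegral_sum_indicator_mul (hm : ∀ J ∈ R, MeasurableSet J) (w : Set X → ℝ≥0∞)
    {G : X → ℝ≥0∞} (hG : AEMeasurable G ν) :
    ∫⁻ x, (∑ J ∈ R, J.indicator (fun _ => w J) x) * G x ∂ν =
      ∑ J ∈ R, w J * ∫⁻ x in J, G x ∂ν := by
  simp_rw [Finset.sum_mul]
  rw [lintegral_finsetSum' _ fun J hJ =>
    (measurable_const.indicator (hm J hJ)).aemeasurable.fun_mul hG]
  refine Finset.sum_congr rfl fun J hJ => ?_
  rw [← lintegral_const_mul'' _ hG.restrict, ← lintegral_indicator (hm J hJ)]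
  simp_rw [Set.indicator_mul_left]

lemma lintegral_sum_indicator (hm : ∀ J ∈ R, MeasurableSet J) (w : Set X → ℝ≥0∞)
    (ν : Measure X) :
    ∫⁻ x, ∑ J ∈ R, J.indicator (fun _ => w J) x ∂ν = ∑ J ∈ R, w J * ν J := by
  simpa using lintegral_sum_indicator_mul (ν := ν) hm w (G := fun _ => 1) aemeasurable_const

open Classical in
lemma IsLaminar.lintegral_sq_sum_indicator_le (hR : IsLaminar (R : Set (Set X)))
    (hm : ∀ J ∈ R, MeasurableSet J) (w : Set X → ℝ≥0∞) (ν : Measure X) :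
    ∫⁻ x, (∑ J ∈ R, J.indicator (fun _ => w J) x) ^ 2 ∂ν ≤
      2 * ∑ J ∈ R, w J * ∑ K ∈ R with K ⊆ J, w K * ν K := by
  have hmJ : ∀ J, ∀ K ∈ {K ∈ R | K ⊆ J}, MeasurableSet K :=
    fun J K hK => hm K (Finset.mem_filter.1 hK).1
  have meas_inner (J : Set X) : Measurable fun x =>
      w J * ∑ K ∈ R with K ⊆ J, K.indicator (fun _ => w K) x :=
    (measurable_sum_indicator (hmJ J) w).const_mul _
  refine (lintegral_mono (hR.sq_sum_indicator_le w)).trans_eq ?_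
  rw [lintegral_const_mul _ (Finset.measurable_sum _ fun J _ => meas_inner J),
    lintegral_finsetSum _ fun J _ => meas_inner J]
  congr 1
  refine Finset.sum_congr rfl fun J _ => ?_
  rw [lintegral_const_mul _ (measurable_sum_indicator (hmJ J) w),
    lintegral_sum_indicator (hmJ J) w]

variable {k : Set X → ℤ} {S J : Set X}

/- Carleson embedding: pairing `∑ a S 𝟏_S` with `F` gives the left side, while the geometric growth
of the averages bounds the square of that function by the left side, which is then absorbed. -/
lemma IsLevel.sum_sq_setLAverage_mul_le {F : X → ℝ≥0∞} {σ : Measure X}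
    (hk : IsLevel R k fun J => ⨍⁻ x in J, F x ∂σ) (hm : ∀ J ∈ R, MeasurableSet J)
    (hR : IsLaminar (R : Set (Set X))) (hF : AEMeasurable F σ)
    (hF0 : ∀ J ∈ R, ⨍⁻ x in J, F x ∂σ ≠ 0) (hFT : ∀ J ∈ R, ⨍⁻ x in J, F x ∂σ ≠ ∞) :
    ∑ S ∈ stoppingSets R k, (⨍⁻ x in S, F x ∂σ) ^ 2 * σ S ≤ 16 * ∫⁻ x, F x ^ 2 ∂σ := by
  set a : Set X → ℝ≥0∞ := fun J => ⨍⁻ x in J, F x ∂σ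
  set W := stoppingSets R k
  have hWR : W ⊆ R := stoppingSets_subset
  have hWm : ∀ S ∈ W, MeasurableSet S := fun S hS => hm S (hWR hS)
  have hσT : ∀ S ∈ W, σ S ≠ ∞ := fun S hS => measure_ne_top_of_setLAverage_ne_zero (hF0 S (hWR hS))
  set h : X → ℝ≥0∞ := fun x => ∑ S ∈ W, S.indicator (fun _ => a S) x
  have h_meas : Measurable h := measurable_sum_indicator hWm a
  have sum_ne_top : ∑ S ∈ W, a S ^ 2 * σ S ≠ ∞ := ENNReal.sum_ne_top.2 fun S hS =>
    ENNReal.mul_ne_top (ENNReal.pow_ne_top (hFT S (hWR hS))) (hσT S hS)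
  have pairing_eq : ∫⁻ x, h x * F x ∂σ = ∑ S ∈ W, a S ^ 2 * σ S := by
    rw [lintegral_sum_indicator_mul hWm a hF]
    refine Finset.sum_congr rfl fun S hS => ?_
    rw [← measure_mul_setLAverage F (hσT S hS)]
    ring
  have sq_le : ∫⁻ x, h x ^ 2 ∂σ ≤ 16 * ∑ S ∈ W, a S ^ 2 * σ S := by
    rw [← lintegral_sum_indicator hWm (fun S => a S ^ 2),
      ← lintegral_const_mul _ (measurable_sum_indicator hWm fun S => a S ^ 2)]
    exact lintegral_mono (hk.sq_sum_indicator_le hR)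
  rw [← ENNReal.add_le_add_iff_left sum_ne_top, ← two_mul]
  calc 2 * ∑ S ∈ W, a S ^ 2 * σ S
      ≤ 16⁻¹ * ∫⁻ x, h x ^ 2 ∂σ + 16 * ∫⁻ x, F x ^ 2 ∂σ :=
        pairing_eq ▸ two_mul_lintegral_mul_le h_meas.aemeasurable hF 16
    _ ≤ 16⁻¹ * (16 * ∑ S ∈ W, a S ^ 2 * σ S) + 16 * ∫⁻ x, F x ^ 2 ∂σ := by gcongr
    _ = ∑ S ∈ W, a S ^ 2 * σ S + 16 * ∫⁻ x, F x ^ 2 ∂σ := by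
        rw [← mul_assoc, ENNReal.inv_mul_cancel (by norm_num) ENNReal.ofNat_ne_top, one_mul]

lemma measurableSet_stoppingCore (hm : ∀ J ∈ R, MeasurableSet J) (hS : S ∈ R) :
    MeasurableSet (stoppingCore R k S) :=
  (hm S hS).diff (Finset.measurableSet_biUnion _ fun J hJ => hm J (stoppingChildren_subset hJ))

lemma setLIntegral_eq_stoppingCore_add_sum_stoppingChildren (hm : ∀ J ∈ R, MeasurableSet J)
    (hR : IsLaminar (R : Set (Set X))) (f : X → ℝ≥0∞) (ν : Measure X) :
    ∫⁻ x in S, f x ∂ν =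
      ∫⁻ x in stoppingCore R k S, f x ∂ν + ∑ J ∈ stoppingChildren R k S, ∫⁻ x in J, f x ∂ν := by
  have hmC : ∀ J ∈ stoppingChildren R k S, MeasurableSet J :=
    fun J hJ => hm J (stoppingChildren_subset hJ)
  have hsub : ⋃ J ∈ stoppingChildren R k S, J ⊆ S :=
    Set.iUnion₂_subset fun J hJ => (mem_stoppingChildren.1 hJ).2.1
  rw [← lintegral_inter_add_sdiff f S (Finset.measurableSet_biUnion _ hmC),
    Set.inter_eq_right.2 hsub, add_comm, stoppingCore]
  congr 1
  exact lintegral_biUnion_finset (pairwiseDisjoint_stoppingChildren_id hR S) hmC f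

/-- The function `G` on `S` with its values on each stopping child replaced by its `ω`-average
there, extended by `0`. On the corona of `S` it has the same integrals as `G`. -/
noncomputable def stoppingProjection (ω : Measure X) (R : Finset (Set X)) (k : Set X → ℤ)
    (G : X → ℝ≥0∞) (S : Set X) (x : X) : ℝ≥0∞ :=
  (stoppingCore R k S).indicator G x +
    ∑ K ∈ stoppingChildren R k S, K.indicator (fun _ => ⨍⁻ y in K, G y ∂ω) x

variable {ω : Measure X} {G : X → ℝ≥0∞}

lemma aemeasurable_stoppingProjection (hm : ∀ J ∈ R, MeasurableSet J) (hS : S ∈ R)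
    (hG : AEMeasurable G ω) : AEMeasurable (stoppingProjection ω R k G S) ω :=
  (hG.indicator (measurableSet_stoppingCore hm hS)).add
    (measurable_sum_indicator (fun J hJ => hm J (stoppingChildren_subset hJ)) _).aemeasurable

lemma stoppingProjection_of_mem_stoppingCore {x : X} (hx : x ∈ stoppingCore R k S) :
    stoppingProjection ω R k G S x = G x := by
  rw [stoppingProjection, Set.indicator_of_mem hx, Finset.sum_eq_zero, add_zero]
  exact fun K hK => Set.indicator_of_notMem (fun hxK => hx.2 (Set.mem_biUnion hK hxK)) _

lemma stoppingProjection_of_mem_stoppingChildren (hR : IsLaminar (R : Set (Set X)))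
    (hJ : J ∈ stoppingChildren R k S) {x : X} (hx : x ∈ J) :
    stoppingProjection ω R k G S x = ⨍⁻ y in J, G y ∂ω := by
  have hcore : x ∉ stoppingCore R k S := fun h => h.2 (Set.mem_biUnion hJ hx)
  rw [stoppingProjection, Set.indicator_of_notMem hcore, zero_add,
    Finset.sum_eq_single_of_mem J hJ, Set.indicator_of_mem hx]
  exact fun K hK hKJ => Set.indicator_of_notMem
    (Set.disjoint_right.1 (pairwiseDisjoint_stoppingChildren_id hR S hK hJ hKJ) hx) _

lemma stoppingProjection_of_notMem {x : X} (hx : x ∉ S) :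
    stoppingProjection ω R k G S x = 0 := by
  rw [stoppingProjection, Set.indicator_of_notMem fun h => hx (stoppingCore_subset h),
    Finset.sum_eq_zero, add_zero]
  exact fun K hK => Set.indicator_of_notMem (fun h => hx ((mem_stoppingChildren.1 hK).2.1 h)) _

lemma lintegral_sq_stoppingProjection (hm : ∀ J ∈ R, MeasurableSet J)
    (hR : IsLaminar (R : Set (Set X))) (hS : S ∈ R) :
    ∫⁻ x, stoppingProjection ω R k G S x ^ 2 ∂ω =
      ∫⁻ x in stoppingCore R k S, G x ^ 2 ∂ω +
        ∑ K ∈ stoppingChildren R k S, (⨍⁻ x in K, G x ∂ω) ^ 2 * ω K := by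
  have hsupp : (fun x => stoppingProjection ω R k G S x ^ 2).support ⊆ S :=
    Function.support_subset_iff'.2 fun x hx => by simp [stoppingProjection_of_notMem hx]
  rw [← setLIntegral_eq_of_support_subset hsupp,
    setLIntegral_eq_stoppingCore_add_sum_stoppingChildren (k := k) hm hR]
  congr 1
  · exact setLIntegral_congr_fun (measurableSet_stoppingCore hm hS) fun x hx => by
      simp only [stoppingProjection_of_mem_stoppingCore hx]
  · refine Finset.sum_congr rfl fun K hK => ?_
    rw [← setLIntegral_const]
    exact setLIntegral_congr_fun (hm K (stoppingChildren_subset hK)) fun x hx => by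
      simp only [stoppingProjection_of_mem_stoppingChildren hR hK hx]

lemma setLIntegral_stoppingProjection (hm : ∀ J ∈ R, MeasurableSet J)
    (hR : IsLaminar (R : Set (Set X))) (hk : AntitoneOn k (R : Set (Set X)))
    (hω : ∀ J ∈ R, ω J ≠ ∞) (hS : S ∈ R) (hJ : J ∈ corona R k S) :
    ∫⁻ x in J, stoppingProjection ω R k G S x ∂ω = ∫⁻ x in J, G x ∂ω := by
  obtain ⟨hJR, hJS, hkJ⟩ := mem_corona.1 hJ
  have setLIntegral_restrict (f : X → ℝ≥0∞) :
      ∫⁻ x in S, f x ∂ω.restrict J = ∫⁻ x in J, f x ∂ω := by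
    rw [Measure.restrict_restrict (hm S hS), Set.inter_eq_right.2 hJS]
  rw [← setLIntegral_restrict, ← setLIntegral_restrict,
    setLIntegral_eq_stoppingCore_add_sum_stoppingChildren (k := k) hm hR,
    setLIntegral_eq_stoppingCore_add_sum_stoppingChildren (k := k) hm hR G]
  congr 1
  · exact setLIntegral_congr_fun (measurableSet_stoppingCore hm hS) fun x hx =>
      stoppingProjection_of_mem_stoppingCore hx
  · refine Finset.sum_congr rfl fun K hK => ?_
    obtain ⟨hKR, -, hkK, -⟩ := mem_stoppingChildren.1 hK
    rw [setLIntegral_congr_fun (hm K hKR) fun x hx =>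
      stoppingProjection_of_mem_stoppingChildren hR hK hx, setLIntegral_const,
      Measure.restrict_restrict (hm K hKR), Measure.restrict_apply (hm K hKR)]
    rcases hR K hKR J hJR with h | h | h
    · rw [Set.inter_eq_left.2 h, mul_comm, measure_mul_setLAverage G (hω K hKR)]
    · have := hk hJR hKR h
      omega
    · simp [h.inter_eq]

lemma sum_lintegral_sq_stoppingProjection_le (hm : ∀ J ∈ R, MeasurableSet J)
    (hR : IsLaminar (R : Set (Set X))) (hne : ∀ J ∈ R, J.Nonempty)
    (hk : AntitoneOn k (R : Set (Set X))) :
    ∑ S ∈ stoppingSets R k, ∫⁻ x, stoppingProjection ω R k G S x ^ 2 ∂ω ≤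
      ∫⁻ x, G x ^ 2 ∂ω + ∑ S ∈ stoppingSets R k, (⨍⁻ x in S, G x ∂ω) ^ 2 * ω S := by
  rw [Finset.sum_congr rfl fun S hS =>
    lintegral_sq_stoppingProjection hm hR (stoppingSets_subset hS), Finset.sum_add_distrib]
  refine add_le_add ?_ ?_
  · rw [← lintegral_biUnion_finset (pairwiseDisjoint_stoppingCore hR hne hk)
      fun S hS => measurableSet_stoppingCore hm (stoppingSets_subset hS)]
    exact setLIntegral_le_lintegral _ _
  · rw [← Finset.sum_biUnion (pairwiseDisjoint_stoppingChildren hR hne)]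
    exact Finset.sum_le_sum_of_subset
      (Finset.biUnion_subset.2 fun S _ => stoppingChildren_subset_stoppingSets)

open Classical in
lemma IsLevel.sum_corona_mul_le {a : Set X → ℝ≥0∞} (hk : IsLevel R k a)
    (hm : ∀ J ∈ R, MeasurableSet J) (hR : IsLaminar (R : Set (Set X))) (hω : ∀ J ∈ R, ω J ≠ ∞)
    (hG : AEMeasurable G ω) (hS : S ∈ stoppingSets R k) (w : Set X → ℝ≥0∞) {κ s : ℝ≥0∞}
    (htest : ∫⁻ x, (∑ J ∈ R with J ⊆ S, J.indicator (fun _ => w J) x) ^ 2 ∂ω ≤ κ ^ 2 * s) :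
    ∑ J ∈ corona R k S, a J * (w J * ∫⁻ x in J, G x ∂ω) ≤
      κ * (a S ^ 2 * s + ∫⁻ x, stoppingProjection ω R k G S x ^ 2 ∂ω) := by
  have hSR := stoppingSets_subset hS
  have hmC : ∀ J ∈ corona R k S, MeasurableSet J := fun J hJ => hm J (corona_subset hJ)
  set P := stoppingProjection ω R k G S
  have hP : AEMeasurable P ω := aemeasurable_stoppingProjection hm hSR hG
  set h : X → ℝ≥0∞ := fun x => ∑ J ∈ corona R k S, J.indicator (fun _ => w J) x
  have h_meas : Measurable h := measurable_sum_indicator hmC w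
  have h_sq_le : ∫⁻ x, h x ^ 2 ∂ω ≤ κ ^ 2 * s := by
    refine le_trans (lintegral_mono fun x => ?_) htest
    refine pow_le_pow_left' (Finset.sum_le_sum_of_subset fun J hJ => ?_) 2
    exact Finset.mem_filter.2 ⟨corona_subset hJ, (mem_corona.1 hJ).2.1⟩
  calc ∑ J ∈ corona R k S, a J * (w J * ∫⁻ x in J, G x ∂ω)
      ≤ ∑ J ∈ corona R k S, 2 * a S * (w J * ∫⁻ x in J, P x ∂ω) := by
        refine Finset.sum_le_sum fun J hJ => ?_
        rw [setLIntegral_stoppingProjection hm hR hk.antitoneOn hω hSR hJ]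
        gcongr
        exact hk.le_two_mul hS hJ
    _ = 2 * ∫⁻ x, a S * h x * P x ∂ω := by
        rw [← Finset.mul_sum, ← lintegral_sum_indicator_mul hmC w hP, mul_assoc,
          ← lintegral_const_mul'' _ (h_meas.aemeasurable.fun_mul hP)]
        simp_rw [mul_assoc]
    _ ≤ κ⁻¹ * ∫⁻ x, (a S * h x) ^ 2 ∂ω + κ * ∫⁻ x, P x ^ 2 ∂ω :=
        two_mul_lintegral_mul_le (h_meas.const_mul _).aemeasurable hP κ
    _ = κ⁻¹ * (a S ^ 2 * ∫⁻ x, h x ^ 2 ∂ω) + κ * ∫⁻ x, P x ^ 2 ∂ω := by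
        simp_rw [mul_pow]
        rw [lintegral_const_mul _ (h_meas.pow_const 2)]
    _ ≤ κ⁻¹ * (a S ^ 2 * (κ ^ 2 * s)) + κ * ∫⁻ x, P x ^ 2 ∂ω := by gcongr
    _ = κ⁻¹ * κ * (κ * (a S ^ 2 * s)) + κ * ∫⁻ x, P x ^ 2 ∂ω := by ring
    _ ≤ 1 * (κ * (a S ^ 2 * s)) + κ * ∫⁻ x, P x ^ 2 ∂ω := by
        gcongr
        exact ENNReal.inv_mul_le_one κ
    _ = κ * (a S ^ 2 * s + ∫⁻ x, P x ^ 2 ∂ω) := by ring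

/- Under the domination hypothesis `hFG` only one of the two testing conditions of the two weight
theorem is needed: the averages of `G` over the stopping children are controlled by the Carleson
embedding for `F`. -/
open Classical in
theorem sum_setLAverage_mul_le_of_testing {σ : Measure X} {F : X → ℝ≥0∞}
    (hm : ∀ J ∈ R, MeasurableSet J) (hR : IsLaminar (R : Set (Set X))) (hω : ∀ J ∈ R, ω J ≠ ∞)
    (hF : AEMeasurable F σ) (hG : AEMeasurable G ω)
    (hF0 : ∀ J ∈ R, ⨍⁻ x in J, F x ∂σ ≠ 0) (hFT : ∀ J ∈ R, ⨍⁻ x in J, F x ∂σ ≠ ∞)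
    (hFG : ∀ J ∈ R, (⨍⁻ x in J, G x ∂ω) ^ 2 * ω J ≤ (⨍⁻ x in J, F x ∂σ) ^ 2 * σ J)
    (w : Set X → ℝ≥0∞) {κ : ℝ≥0∞}
    (htest : ∀ I ∈ R,
      ∫⁻ x, (∑ J ∈ R with J ⊆ I, J.indicator (fun _ => w J) x) ^ 2 ∂ω ≤ κ ^ 2 * σ I) :
    ∑ J ∈ R, (⨍⁻ x in J, F x ∂σ) * (w J * ∫⁻ x in J, G x ∂ω) ≤
      32 * κ * (∫⁻ x, F x ^ 2 ∂σ + ∫⁻ x, G x ^ 2 ∂ω) := by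
  obtain ⟨k, hk⟩ := exists_isLevel hF0 hFT
  have hne : ∀ J ∈ R, J.Nonempty := fun J hJ =>
    nonempty_of_measure_ne_zero (measure_ne_zero_of_setLAverage_ne_zero (hF0 J hJ))
  set W := stoppingSets R k
  have carleson : ∑ S ∈ W, (⨍⁻ x in S, F x ∂σ) ^ 2 * σ S ≤ 16 * ∫⁻ x, F x ^ 2 ∂σ :=
    hk.sum_sq_setLAverage_mul_le hm hR hF hF0 hFT
  have projections :=
    sum_lintegral_sq_stoppingProjection_le (ω := ω) (G := G) hm hR hne hk.antitoneOn
  have dominated : ∑ S ∈ W, (⨍⁻ x in S, G x ∂ω) ^ 2 * ω S ≤ 16 * ∫⁻ x, F x ^ 2 ∂σ :=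
    (Finset.sum_le_sum fun S hS => hFG S (stoppingSets_subset hS)).trans carleson
  calc ∑ J ∈ R, (⨍⁻ x in J, F x ∂σ) * (w J * ∫⁻ x in J, G x ∂ω)
      ≤ ∑ S ∈ W, ∑ J ∈ corona R k S, (⨍⁻ x in J, F x ∂σ) * (w J * ∫⁻ x in J, G x ∂ω) :=
        sum_le_sum_sum_corona hk.antitoneOn _
    _ ≤ ∑ S ∈ W, κ * ((⨍⁻ x in S, F x ∂σ) ^ 2 * σ S +
          ∫⁻ x, stoppingProjection ω R k G S x ^ 2 ∂ω) :=
        Finset.sum_le_sum fun S hS =>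
          hk.sum_corona_mul_le hm hR hω hG hS w (htest S (stoppingSets_subset hS))
    _ ≤ κ * (16 * ∫⁻ x, F x ^ 2 ∂σ + (∫⁻ x, G x ^ 2 ∂ω + 16 * ∫⁻ x, F x ^ 2 ∂σ)) := by
        rw [← Finset.mul_sum, Finset.sum_add_distrib]
        gcongr
        exact projections.trans (add_le_add_right dominated _)
    _ = κ * (32 * ∫⁻ x, F x ^ 2 ∂σ + 1 * ∫⁻ x, G x ^ 2 ∂ω) := by ring
    _ ≤ κ * (32 * ∫⁻ x, F x ^ 2 ∂σ + 32 * ∫⁻ x, G x ^ 2 ∂ω) := by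
        gcongr
        norm_num
    _ = 32 * κ * (∫⁻ x, F x ^ 2 ∂σ + ∫⁻ x, G x ^ 2 ∂ω) := by ring

end Embedding

section Sparse

variable {X : Type*} [MeasurableSpace X] {μ : Measure X}

/-- The measure with density `u` with respect to `μ`, written `u dx` in the paper. -/
noncomputable abbrev weightMeasure (μ : Measure X) (u : X → ℝ≥0) : Measure X :=
  μ.withDensity fun x => (u x : ℝ≥0∞)

namespace AtomicFiltration

variable (𝓕 : AtomicFiltration μ)

lemma subset_or_disjoint_of_mem_atoms {n m : ℤ} (hnm : n ≤ m) {I J : Set X}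
    (hI : I ∈ 𝓕.atoms n) (hJ : J ∈ 𝓕.atoms m) : J ⊆ I ∨ Disjoint I J := by
  obtain ⟨S, hS, rfl⟩ := 𝓕.exists_eq_sUnion m I
    (𝓕.filtration.mono hnm _ (𝓕.measurableSet_atom n I hI))
  by_cases hJS : J ∈ S
  · exact .inl (Set.subset_sUnion_of_mem hJS)
  · refine .inr (Set.disjoint_sUnion_left.2 fun K hK => ?_)
    exact 𝓕.pairwiseDisjoint_atoms m (hS hK) hJ fun h => hJS (h ▸ hK)

lemma isLaminar_lattice : IsLaminar 𝓕.lattice := by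
  intro I hI J hJ
  obtain ⟨n, hn⟩ := Set.mem_iUnion.1 hI
  obtain ⟨m, hm⟩ := Set.mem_iUnion.1 hJ
  rcases le_total n m with h | h
  · exact .inr (𝓕.subset_or_disjoint_of_mem_atoms h hn hm)
  · exact (𝓕.subset_or_disjoint_of_mem_atoms h hm hn).imp_right fun h => .inr h.symm

lemma countable_lattice : 𝓕.lattice.Countable :=
  Set.countable_iUnion 𝓕.countable_atoms

variable {𝓕} {u v : X → ℝ≥0} {I J : Set X}

lemma measurableSet_of_mem_lattice (hI : I ∈ 𝓕.lattice) : MeasurableSet I := by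
  obtain ⟨n, hn⟩ := Set.mem_iUnion.1 hI
  exact 𝓕.filtration.le n _ (𝓕.measurableSet_atom n I hn)

lemma measure_ne_zero_of_mem_lattice (hI : I ∈ 𝓕.lattice) : μ I ≠ 0 := by
  obtain ⟨n, hn⟩ := Set.mem_iUnion.1 hI
  exact (𝓕.measure_atom_pos n I hn).ne'

lemma measure_ne_top_of_mem_lattice (hI : I ∈ 𝓕.lattice) : μ I ≠ ∞ := by
  obtain ⟨n, hn⟩ := Set.mem_iUnion.1 hI
  exact (𝓕.measure_atom_lt_top n I hn).ne

lemma avg_mul_measure (u : X → ℝ≥0) (hJ : J ∈ 𝓕.lattice) :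
    𝓕.avg u J * μ J = weightMeasure μ u J := by
  rw [mul_comm, avg, measure_mul_setLAverage _ (measure_ne_top_of_mem_lattice hJ),
    withDensity_apply _ (measurableSet_of_mem_lattice hJ)]

lemma entropyAvg_mul_measure (u : X → ℝ≥0) (hI : I ∈ 𝓕.lattice) :
    𝓕.entropyAvg u I * μ I =
      ∫⁻ x in I, 𝓕.maximal (I.indicator fun y => (u y : ℝ≥0∞)) x ∂μ := by
  rw [mul_comm, entropyAvg, measure_mul_setLAverage _ (measure_ne_top_of_mem_lattice hI)]

lemma avg_le_maximal (u : X → ℝ≥0) (hJ : J ∈ 𝓕.lattice) (hJI : J ⊆ I) {x : X} (hx : x ∈ J) :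
    𝓕.avg u J ≤ 𝓕.maximal (I.indicator fun y => (u y : ℝ≥0∞)) x := by
  calc 𝓕.avg u J = ⨍⁻ y in J, I.indicator (fun y => (u y : ℝ≥0∞)) y ∂μ :=
        setLAverage_congr_fun (measurableSet_of_mem_lattice hJ)
          fun y hy => by rw [Set.indicator_of_mem (hJI hy)]
    _ ≤ 𝓕.maximal (I.indicator fun y => (u y : ℝ≥0∞)) x :=
        le_iSup_of_le J (le_iSup_of_le hJ (le_iSup_of_le hx le_rfl))

lemma avg_le_entropyAvg (u : X → ℝ≥0) (hI : I ∈ 𝓕.lattice) :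
    𝓕.avg u I ≤ 𝓕.entropyAvg u I := by
  rw [← ENNReal.mul_le_mul_iff_left (measure_ne_zero_of_mem_lattice hI)
    (measure_ne_top_of_mem_lattice hI), entropyAvg_mul_measure u hI, ← setLIntegral_const]
  exact setLIntegral_mono' (measurableSet_of_mem_lattice hI)
    fun x hx => avg_le_maximal u hI subset_rfl hx

lemma IsSparse.mono {Q Q' : Set (Set X)} (hQ : 𝓕.IsSparse Q) (h : Q' ⊆ Q) : 𝓕.IsSparse Q' where
  subset_lattice := h.trans hQ.subset_lattice
  measure_le I hI := by
    refine (measure_mono (Set.sUnion_subset_sUnion ?_)).trans (hQ.measure_le I (h hI))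
    exact fun J hJ => ⟨h hJ.1, hJ.2⟩

lemma IsSparse.measurableSet_exclusivePart {Q : Set (Set X)} (hQ : 𝓕.IsSparse Q) (hJ : J ∈ Q) :
    MeasurableSet (exclusivePart Q J) := by
  refine (measurableSet_of_mem_lattice (hQ.subset_lattice hJ)).diff (.sUnion ?_ fun K hK => ?_)
  · exact 𝓕.countable_lattice.mono fun K hK => hQ.subset_lattice hK.1
  · exact measurableSet_of_mem_lattice (hQ.subset_lattice hK.1)

lemma IsSparse.measure_le_two_mul_exclusivePart {Q : Set (Set X)} (hQ : 𝓕.IsSparse Q)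
    (hJ : J ∈ Q) : μ J ≤ 2 * μ (exclusivePart Q J) := by
  refine le_two_mul_of_le_add_half (measure_ne_top_of_mem_lattice (hQ.subset_lattice hJ)) ?_
  calc μ J ≤ μ (exclusivePart Q J ∪ ⋃₀ {K | K ∈ Q ∧ K ⊂ J}) :=
        measure_mono (Set.subset_sdiff_union _ _)
    _ ≤ μ (exclusivePart Q J) + μ (⋃₀ {K | K ∈ Q ∧ K ⊂ J}) := measure_union_le _ _
    _ ≤ μ (exclusivePart Q J) + μ J / 2 := by
        gcongr
        exact hQ.measure_le J hJ

variable {R : Finset (Set X)}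

lemma IsSparse.sum_mul_measure_le (hR : 𝓕.IsSparse (R : Set (Set X))) (hRI : ∀ J ∈ R, J ⊆ I)
    {c : Set X → ℝ≥0∞} {φ : X → ℝ≥0∞} (hc : ∀ J ∈ R, ∀ x ∈ J, c J ≤ φ x) :
    ∑ J ∈ R, c J * μ J ≤ 2 * ∫⁻ x in I, φ x ∂μ := by
  set E : Set X → Set X := exclusivePart (R : Set (Set X))
  have hEm : ∀ J ∈ R, MeasurableSet (E J) := fun J hJ => hR.measurableSet_exclusivePart hJ
  calc ∑ J ∈ R, c J * μ J ≤ ∑ J ∈ R, 2 * ∫⁻ x in E J, φ x ∂μ := by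
        refine Finset.sum_le_sum fun J hJ => ?_
        calc c J * μ J ≤ c J * (2 * μ (E J)) := by
              gcongr
              exact hR.measure_le_two_mul_exclusivePart hJ
          _ = 2 * ∫⁻ _ in E J, c J ∂μ := by
              rw [setLIntegral_const]
              ring
          _ ≤ 2 * ∫⁻ x in E J, φ x ∂μ := by
              gcongr 2 * ?_
              exact setLIntegral_mono' (hEm J hJ) fun x hx => hc J hJ x (exclusivePart_subset hx)
    _ = 2 * ∫⁻ x in ⋃ J ∈ R, E J, φ x ∂μ := by
        rw [← Finset.mul_sum, lintegral_biUnion_finset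
          (𝓕.isLaminar_lattice.mono hR.subset_lattice).pairwiseDisjoint_exclusivePart hEm]
    _ ≤ 2 * ∫⁻ x in I, φ x ∂μ := by
        gcongr
        exact Set.iUnion₂_subset fun J hJ => exclusivePart_subset.trans (hRI J hJ)

lemma IsSparse.sum_measure_le (hR : 𝓕.IsSparse (R : Set (Set X))) (hRI : ∀ J ∈ R, J ⊆ I) :
    ∑ J ∈ R, μ J ≤ 2 * μ I := by
  simpa using hR.sum_mul_measure_le hRI (c := fun _ => 1) (φ := fun _ => 1) (by simp)

lemma IsSparse.sum_weightMeasure_le (hR : 𝓕.IsSparse (R : Set (Set X))) (hRI : ∀ J ∈ R, J ⊆ I)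
    (u : X → ℝ≥0) (hI : I ∈ 𝓕.lattice) :
    ∑ J ∈ R, weightMeasure μ u J ≤ 2 * (𝓕.entropyAvg u I * μ I) := by
  rw [entropyAvg_mul_measure u hI,
    Finset.sum_congr rfl fun J hJ => (avg_mul_measure u (hR.subset_lattice hJ)).symm]
  exact hR.sum_mul_measure_le hRI fun J hJ x hx =>
    avg_le_maximal u (hR.subset_lattice hJ) (hRI J hJ) hx

/- Sparseness is used twice: for `μ` below each `J ∈ R`, after `v_K u_K ≤ c`, and for the weight `u`
below `I`, where the entropy average enters. -/
open Classical in
lemma IsSparse.lintegral_sq_sum_avg_le (hR : 𝓕.IsSparse (R : Set (Set X)))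
    (hRI : ∀ J ∈ R, J ⊆ I) (hI : I ∈ 𝓕.lattice) {c D : ℝ≥0∞}
    (hc : ∀ J ∈ R, 𝓕.avg u J * 𝓕.avg v J ≤ c) (hD : 𝓕.entropyAvg u I ≤ D * 𝓕.avg u I) :
    ∫⁻ x, (∑ J ∈ R, J.indicator (fun _ => 𝓕.avg u J) x) ^ 2 ∂(weightMeasure μ v) ≤
      8 * c * D * weightMeasure μ u I := by
  have hlat : ∀ J ∈ R, J ∈ 𝓕.lattice := fun J hJ => hR.subset_lattice hJ
  have inner_le (J : Set X) :
      ∑ K ∈ R with K ⊆ J, 𝓕.avg u K * weightMeasure μ v K ≤ c * (2 * μ J) := by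
    calc ∑ K ∈ R with K ⊆ J, 𝓕.avg u K * weightMeasure μ v K
        ≤ ∑ K ∈ R with K ⊆ J, c * μ K := by
          refine Finset.sum_le_sum fun K hK => ?_
          have hKR := (Finset.mem_filter.1 hK).1
          rw [← avg_mul_measure v (hlat K hKR), ← mul_assoc]
          gcongr
          exact hc K hKR
      _ ≤ c * (2 * μ J) := by
          rw [← Finset.mul_sum]
          gcongr
          exact (hR.mono (Finset.filter_subset _ _)).sum_measure_le
            fun K hK => (Finset.mem_filter.1 hK).2
  calc ∫⁻ x, (∑ J ∈ R, J.indicator (fun _ => 𝓕.avg u J) x) ^ 2 ∂(weightMeasure μ v)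
      ≤ 2 * ∑ J ∈ R, 𝓕.avg u J * ∑ K ∈ R with K ⊆ J, 𝓕.avg u K * weightMeasure μ v K :=
        (𝓕.isLaminar_lattice.mono hlat).lintegral_sq_sum_indicator_le
          (fun J hJ => measurableSet_of_mem_lattice (hlat J hJ)) _ _
    _ ≤ 2 * ∑ J ∈ R, 𝓕.avg u J * (c * (2 * μ J)) := by
        gcongr with J
        exact inner_le J
    _ = 4 * c * ∑ J ∈ R, weightMeasure μ u J := by
        rw [Finset.mul_sum, Finset.mul_sum]
        refine Finset.sum_congr rfl fun J hJ => ?_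
        rw [← avg_mul_measure u (hlat J hJ)]
        ring
    _ ≤ 4 * c * (2 * (D * 𝓕.avg u I * μ I)) := by
        gcongr
        refine (hR.sum_weightMeasure_le hRI u hI).trans ?_
        gcongr
    _ = 8 * c * D * weightMeasure μ u I := by
        rw [← avg_mul_measure u hI]
        ring

end AtomicFiltration

end Sparse

section Penalty

/-- A penalty function `α : [1, ∞) → (0, ∞)`: `t α(t)` is non-decreasing and `∫₁^∞ dt / (t α(t))` is
finite. The values of `α` below `1` play no role. -/
structure IsPenalty (α : ℝ → ℝ) : Prop where
  pos : ∀ t, 1 ≤ t → 0 < α t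
  monotoneOn : MonotoneOn (fun t => t * α t) (Ici 1)
  integrableOn : IntegrableOn (fun t => 1 / (t * α t)) (Ioi 1)

variable {α : ℝ → ℝ}

lemma IsPenalty.antitoneOn (hα : IsPenalty α) : AntitoneOn (fun t => 1 / (t * α t)) (Ici 1) := by
  intro s hs t ht hst
  have hs1 : 1 ≤ s := hs
  exact one_div_le_one_div_of_le (mul_pos (by linarith) (hα.pos s hs)) (hα.monotoneOn hs ht hst)

/- Cauchy condensation: `∑ 2ⁿ / (2ⁿ α(2ⁿ))` converges together with `∑ 1 / (n α(n))`. -/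
lemma IsPenalty.summable_one_div_comp_two_pow (hα : IsPenalty α) :
    Summable fun n : ℕ => 1 / α (2 ^ n) := by
  have nonneg (t : ℝ) (ht : 1 ≤ t) : 0 ≤ 1 / (t * α t) :=
    one_div_nonneg.2 (mul_pos (by linarith) (hα.pos t ht)).le
  have summable_nat : Summable fun n : ℕ => 1 / ((n : ℝ) * α n) :=
    AntitoneOn.summable_of_integrableOn_Ioi (N := 1) (f := fun t => 1 / (t * α t))
      (by simpa using hα.antitoneOn) (by simpa using hα.integrableOn)
      fun t ht => nonneg t (le_of_lt (by simpa using ht))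
  rw [← summable_condensed_iff_of_nonneg] at summable_nat
  · refine summable_nat.congr fun n => ?_
    push_cast
    field_simp
  · intro n
    rcases Nat.eq_zero_or_pos n with rfl | hn
    · simp
    · exact nonneg n (by exact_mod_cast hn)
  · intro m n hm hmn
    have hm' : (1 : ℝ) ≤ m := by exact_mod_cast hm
    have hmn' : (m : ℝ) ≤ n := by exact_mod_cast hmn
    exact hα.antitoneOn hm' (hm'.trans hmn') hmn'

lemma IsPenalty.mul_sq_le (hα : IsPenalty α) {s t : ℝ} (hs : 1 ≤ s) (hst : s ≤ t)
    (hts : t ≤ 2 * s) : s * α s ^ 2 ≤ 2 * (t * α t ^ 2) := by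
  have hs0 : 0 < s := by linarith
  have hαs := hα.pos s hs
  have ht0 : 0 < t := hs0.trans_le hst
  refine le_of_mul_le_mul_left ?_ hs0
  calc s * (s * α s ^ 2) = (s * α s) ^ 2 := by ring
    _ ≤ (t * α t) ^ 2 := by
        gcongr ?_ ^ 2
        exact hα.monotoneOn hs (hs.trans hst) hst
    _ = t * (t * α t ^ 2) := by ring
    _ ≤ 2 * s * (t * α t ^ 2) := by gcongr
    _ = s * (2 * (t * α t ^ 2)) := by ring

end Penalty

section Classes

variable {X : Type*} [MeasurableSpace X] {μ : Measure X} {𝓕 : AtomicFiltration μ} {α : ℝ → ℝ}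
  {u v : X → ℝ≥0}

namespace AtomicFiltration

lemma avg_ne_top {I : Set X} (hI : I ∈ 𝓕.lattice) (hu : ∫⁻ x in I, (u x : ℝ≥0∞) ∂μ < ∞) :
    𝓕.avg u I ≠ ∞ := by
  rw [avg, setLAverage_eq]
  exact ENNReal.div_ne_top hu.ne (measure_ne_zero_of_mem_lattice hI)

/- The class is `n = ⌊log₂ (u*_I / u_I)⌋`. -/
lemma OneSidedBump.exists_entropyClass (hα : IsPenalty α)
    (hu : ∀ I ∈ 𝓕.lattice, ∫⁻ x in I, (u x : ℝ≥0∞) ∂μ < ∞)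
    (hv : ∀ I ∈ 𝓕.lattice, ∫⁻ x in I, (v x : ℝ≥0∞) ∂μ < ∞) (huv : 𝓕.OneSidedBump α u v) :
    ∃ B : ℝ, ∀ I ∈ 𝓕.lattice, 𝓕.avg u I ≠ 0 → 𝓕.avg v I ≠ 0 →
      ∃ n : ℕ, 𝓕.entropyAvg u I ≤ 2 ^ (n + 1) * 𝓕.avg u I ∧
        𝓕.avg u I * 𝓕.avg v I ≤ ENNReal.ofReal (B * (1 / α (2 ^ n))) ^ 2 / 2 ^ (n + 1) := by
  obtain ⟨A, hA⟩ := huv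
  refine ⟨2 * √A, fun I hI hu0 hv0 => ?_⟩
  obtain ⟨hT, hle⟩ := hA I hI hu0 hv0
  have huT := avg_ne_top hI (hu I hI)
  have hvT := avg_ne_top hI (hv I hI)
  set x := (𝓕.avg u I).toReal with hx
  set y := (𝓕.avg v I).toReal with hy
  set z := (𝓕.entropyAvg u I).toReal with hz
  have hx0 : 0 < x := ENNReal.toReal_pos hu0 huT
  have hy0 : 0 < y := ENNReal.toReal_pos hv0 hvT
  have one_le : 1 ≤ z / x := (one_le_div hx0).2 (ENNReal.toReal_mono hT (avg_le_entropyAvg u hI))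
  have hzx : z / x * x = z := div_mul_cancel₀ _ hx0.ne'
  obtain ⟨n, hn, hn'⟩ := exists_nat_pow_near one_le one_lt_two
  have hαn := hα.pos (2 ^ n) (one_le_pow₀ one_le_two)
  refine ⟨n, ?_, ?_⟩
  · rw [← ENNReal.toReal_le_toReal hT (by finiteness), ENNReal.toReal_mul, ← hx, ← hz, ← hzx]
    simp only [ENNReal.toReal_pow, ENNReal.toReal_ofNat]
    gcongr
  · have hA0 : 0 ≤ A := le_trans (by positivity) hle
    rw [ENNReal.le_div_iff_mul_le (by simp) (by simp), ← ENNReal.ofReal_pow (by positivity)]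
    refine (ENNReal.le_ofReal_iff_toReal_le (by finiteness) (by positivity)).2 ?_
    simp only [ENNReal.toReal_mul, ENNReal.toReal_pow, ENNReal.toReal_ofNat, ← hx, ← hy]
    rw [mul_pow, mul_pow, Real.sq_sqrt hA0, one_div, inv_pow, ← div_eq_mul_inv,
      le_div_iff₀ (by positivity)]
    calc x * y * 2 ^ (n + 1) * α (2 ^ n) ^ 2 = 2 * (x * y) * (2 ^ n * α (2 ^ n) ^ 2) := by ring
      _ ≤ 2 * (x * y) * (2 * (z / x * α (z / x) ^ 2)) := by
          gcongr 2 * (x * y) * ?_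
          exact hα.mul_sq_le (one_le_pow₀ one_le_two) hn (by rw [pow_succ'] at hn'; exact hn'.le)
      _ = 2 ^ 2 * (α (z / x) ^ 2 * (z / x * x) * y) := by ring
      _ ≤ 2 ^ 2 * A := by rw [hzx]; gcongr

end AtomicFiltration

end Classes

section BilinearForm

variable {X : Type*} [MeasurableSpace X] {μ σ ω : Measure X} {F G : X → ℝ≥0∞} {J : Set X}

/-- The contribution of `J` to the bilinear form `∫ T(F dσ) G dω` of the sparse operator. -/
noncomputable def pairing (μ σ ω : Measure X) (F G : X → ℝ≥0∞) (J : Set X) : ℝ≥0∞ :=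
  (∫⁻ x in J, F x ∂σ) / μ J * ∫⁻ x in J, G x ∂ω

lemma pairing_comm : pairing μ σ ω F G J = pairing μ ω σ G F J := by
  simp only [pairing, div_eq_mul_inv]
  ring

lemma setLAverage_ne_zero_of_pairing_ne_zero (hJ : σ J ≠ ∞) (h : pairing μ σ ω F G J ≠ 0) :
    ⨍⁻ x in J, F x ∂σ ≠ 0 := fun h0 =>
  h (by rw [pairing, ← measure_mul_setLAverage F hJ, h0]; simp)

lemma setLIntegral_ne_top_of_lintegral_sq_ne_top (hJ : σ J ≠ ∞) (hF : ∫⁻ x, F x ^ 2 ∂σ ≠ ∞) :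
    ∫⁻ x in J, F x ∂σ ≠ ∞ := by
  have le_sq_add_one (x : ℝ≥0∞) : x ≤ x ^ 2 + 1 := by
    rcases le_total x 1 with h | h
    · exact le_add_left h
    · exact le_add_right (le_self_pow₀ h two_ne_zero)
  refine ne_top_of_le_ne_top (ENNReal.add_ne_top.2 ⟨hF, hJ⟩) ?_
  calc ∫⁻ x in J, F x ∂σ ≤ ∫⁻ x in J, (F x ^ 2 + 1) ∂σ := lintegral_mono fun x => le_sq_add_one _
    _ = ∫⁻ x in J, F x ^ 2 ∂σ + σ J := by
        rw [lintegral_add_right _ measurable_const, setLIntegral_one]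
    _ ≤ ∫⁻ x, F x ^ 2 ∂σ + σ J := by
        gcongr
        exact Measure.restrict_le_self

namespace AtomicFiltration

variable {𝓕 : AtomicFiltration μ} {α : ℝ → ℝ} {u v : X → ℝ≥0}

lemma weightMeasure_ne_top (hJ : J ∈ 𝓕.lattice) (hu : ∫⁻ x in J, (u x : ℝ≥0∞) ∂μ < ∞) :
    weightMeasure μ u J ≠ ∞ := by
  rw [withDensity_apply _ (measurableSet_of_mem_lattice hJ)]
  exact hu.ne

lemma avg_ne_zero_of_setLAverage_ne_zero (hJ : J ∈ 𝓕.lattice)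
    (h : ⨍⁻ x in J, F x ∂(weightMeasure μ u) ≠ 0) : 𝓕.avg u J ≠ 0 := fun h0 =>
  measure_ne_zero_of_setLAverage_ne_zero h (by rw [← avg_mul_measure u hJ, h0, zero_mul])

lemma pairing_weightMeasure (hJ : J ∈ 𝓕.lattice) (hu : ∫⁻ x in J, (u x : ℝ≥0∞) ∂μ < ∞) :
    pairing μ (weightMeasure μ u) ω F G J =
      (⨍⁻ x in J, F x ∂(weightMeasure μ u)) * (𝓕.avg u J * ∫⁻ x in J, G x ∂ω) := by
  have avg_eq : 𝓕.avg u J = weightMeasure μ u J / μ J := by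
    rw [avg, setLAverage_eq, withDensity_apply _ (measurableSet_of_mem_lattice hJ)]
  rw [pairing, ← measure_mul_setLAverage F (weightMeasure_ne_top hJ hu), avg_eq]
  simp only [div_eq_mul_inv]
  ring

variable {R : Finset (Set X)}

lemma IsSparse.sum_pairing_le_of_entropyAvg_le (hR : 𝓕.IsSparse (R : Set (Set X)))
    (hu : ∀ I ∈ 𝓕.lattice, ∫⁻ x in I, (u x : ℝ≥0∞) ∂μ < ∞)
    (hv : ∀ I ∈ 𝓕.lattice, ∫⁻ x in I, (v x : ℝ≥0∞) ∂μ < ∞) {κ D : ℝ≥0∞}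
    (hD : ∀ I ∈ R, 𝓕.entropyAvg u I ≤ D * 𝓕.avg u I)
    (hκ : ∀ I ∈ R, 𝓕.avg u I * 𝓕.avg v I ≤ κ ^ 2 / D)
    (hF : AEMeasurable F (weightMeasure μ u)) (hG : AEMeasurable G (weightMeasure μ v))
    (hF0 : ∀ J ∈ R, ⨍⁻ x in J, F x ∂(weightMeasure μ u) ≠ 0)
    (hFT : ∀ J ∈ R, ⨍⁻ x in J, F x ∂(weightMeasure μ u) ≠ ∞)
    (hFG : ∀ J ∈ R, (⨍⁻ x in J, G x ∂(weightMeasure μ v)) ^ 2 * weightMeasure μ v J ≤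
      (⨍⁻ x in J, F x ∂(weightMeasure μ u)) ^ 2 * weightMeasure μ u J) :
    ∑ J ∈ R, pairing μ (weightMeasure μ u) (weightMeasure μ v) F G J ≤
      96 * κ * (∫⁻ x, F x ^ 2 ∂(weightMeasure μ u) + ∫⁻ x, G x ^ 2 ∂(weightMeasure μ v)) := by
  classical
  have hlat : ∀ J ∈ R, J ∈ 𝓕.lattice := fun J hJ => hR.subset_lattice hJ
  have testing (I : Set X) (hI : I ∈ R) :
      ∫⁻ x, (∑ J ∈ R with J ⊆ I, J.indicator (fun _ => 𝓕.avg u J) x) ^ 2 ∂(weightMeasure μ v) ≤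
        (3 * κ) ^ 2 * weightMeasure μ u I := by
    refine ((hR.mono (Finset.filter_subset _ _)).lintegral_sq_sum_avg_le
      (fun J hJ => (Finset.mem_filter.1 hJ).2) (hlat I hI)
      (fun J hJ => hκ J (Finset.mem_filter.1 hJ).1) (hD I hI)).trans ?_
    gcongr
    calc 8 * (κ ^ 2 / D) * D = 8 * (D * (κ ^ 2 / D)) := by ring
      _ ≤ 9 * κ ^ 2 := by
          gcongr
          · norm_num
          · exact ENNReal.mul_div_le
      _ = (3 * κ) ^ 2 := by ring
  rw [Finset.sum_congr rfl fun J hJ => pairing_weightMeasure (hlat J hJ) (hu J (hlat J hJ))]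
  refine (sum_setLAverage_mul_le_of_testing
    (fun J hJ => measurableSet_of_mem_lattice (hlat J hJ)) (𝓕.isLaminar_lattice.mono hlat)
    (fun J hJ => weightMeasure_ne_top (hlat J hJ) (hv J (hlat J hJ))) hF hG hF0 hFT hFG _
    fun I hI => ?_).trans_eq (b := 32 * (3 * κ) * _) (by ring)
  convert testing I hI

lemma IsSparse.sum_pairing_le_of_entropyClass (hR : 𝓕.IsSparse (R : Set (Set X)))
    (hu : ∀ I ∈ 𝓕.lattice, ∫⁻ x in I, (u x : ℝ≥0∞) ∂μ < ∞)
    (hv : ∀ I ∈ 𝓕.lattice, ∫⁻ x in I, (v x : ℝ≥0∞) ∂μ < ∞) {κ D : ℝ≥0∞}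
    (hclass : ∀ I ∈ R, 𝓕.avg u I ≠ 0 → 𝓕.avg v I ≠ 0 →
      𝓕.entropyAvg u I ≤ D * 𝓕.avg u I ∧ 𝓕.avg u I * 𝓕.avg v I ≤ κ ^ 2 / D)
    (hF : AEMeasurable F (weightMeasure μ u)) (hG : AEMeasurable G (weightMeasure μ v))
    (hFT : ∫⁻ x, F x ^ 2 ∂(weightMeasure μ u) ≠ ∞)
    (hFG : ∀ J ∈ R, (⨍⁻ x in J, G x ∂(weightMeasure μ v)) ^ 2 * weightMeasure μ v J ≤
      (⨍⁻ x in J, F x ∂(weightMeasure μ u)) ^ 2 * weightMeasure μ u J) :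
    ∑ J ∈ R, pairing μ (weightMeasure μ u) (weightMeasure μ v) F G J ≤
      96 * κ * (∫⁻ x, F x ^ 2 ∂(weightMeasure μ u) + ∫⁻ x, G x ^ 2 ∂(weightMeasure μ v)) := by
  classical
  set σ := weightMeasure μ u
  set ω := weightMeasure μ v
  set R' := R.filter fun J => pairing μ σ ω F G J ≠ 0
  have hR'R : ∀ J ∈ R', J ∈ R := fun J hJ => (Finset.mem_filter.1 hJ).1
  have hlat : ∀ J ∈ R', J ∈ 𝓕.lattice := fun J hJ => hR.subset_lattice (hR'R J hJ)
  have hσT : ∀ J ∈ R', σ J ≠ ∞ := fun J hJ => weightMeasure_ne_top (hlat J hJ) (hu J (hlat J hJ))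
  have hωT : ∀ J ∈ R', ω J ≠ ∞ := fun J hJ => weightMeasure_ne_top (hlat J hJ) (hv J (hlat J hJ))
  have hF0 : ∀ J ∈ R', ⨍⁻ x in J, F x ∂σ ≠ 0 := fun J hJ =>
    setLAverage_ne_zero_of_pairing_ne_zero (hσT J hJ) (Finset.mem_filter.1 hJ).2
  have hG0 : ∀ J ∈ R', ⨍⁻ x in J, G x ∂ω ≠ 0 := fun J hJ =>
    setLAverage_ne_zero_of_pairing_ne_zero (hωT J hJ)
      (pairing_comm (σ := σ) ▸ (Finset.mem_filter.1 hJ).2)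
  have hF_ne_top : ∀ J ∈ R', ⨍⁻ x in J, F x ∂σ ≠ ∞ := fun J hJ => by
    rw [setLAverage_eq]
    exact ENNReal.div_ne_top (setLIntegral_ne_top_of_lintegral_sq_ne_top (hσT J hJ) hFT)
      (measure_ne_zero_of_setLAverage_ne_zero (hF0 J hJ))
  have hclass' : ∀ J ∈ R', 𝓕.entropyAvg u J ≤ D * 𝓕.avg u J ∧
      𝓕.avg u J * 𝓕.avg v J ≤ κ ^ 2 / D := fun J hJ =>
    hclass J (hR'R J hJ) (avg_ne_zero_of_setLAverage_ne_zero (hlat J hJ) (hF0 J hJ))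
      (avg_ne_zero_of_setLAverage_ne_zero (hlat J hJ) (hG0 J hJ))
  rw [← Finset.sum_filter_ne_zero]
  exact (hR.mono hR'R).sum_pairing_le_of_entropyAvg_le hu hv (fun J hJ => (hclass' J hJ).1)
    (fun J hJ => (hclass' J hJ).2) hF hG hF0
    hF_ne_top fun J hJ => hFG J (hR'R J hJ)

theorem OneSidedBump.exists_sum_pairing_le (hα : IsPenalty α)
    (hu : ∀ I ∈ 𝓕.lattice, ∫⁻ x in I, (u x : ℝ≥0∞) ∂μ < ∞)
    (hv : ∀ I ∈ 𝓕.lattice, ∫⁻ x in I, (v x : ℝ≥0∞) ∂μ < ∞) (huv : 𝓕.OneSidedBump α u v) :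
    ∃ C : ℝ≥0, ∀ R : Finset (Set X), 𝓕.IsSparse (R : Set (Set X)) → ∀ F G : X → ℝ≥0∞,
      AEMeasurable F (weightMeasure μ u) → AEMeasurable G (weightMeasure μ v) →
      ∫⁻ x, F x ^ 2 ∂(weightMeasure μ u) ≠ ∞ →
      (∀ J ∈ R, (⨍⁻ x in J, G x ∂(weightMeasure μ v)) ^ 2 * weightMeasure μ v J ≤
        (⨍⁻ x in J, F x ∂(weightMeasure μ u)) ^ 2 * weightMeasure μ u J) →
      ∑ J ∈ R, pairing μ (weightMeasure μ u) (weightMeasure μ v) F G J ≤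
        C * (∫⁻ x, F x ^ 2 ∂(weightMeasure μ u) + ∫⁻ x, G x ^ 2 ∂(weightMeasure μ v)) := by
  classical
  obtain ⟨B, hB⟩ := huv.exists_entropyClass hα hu hv
  choose! cls hcls using hB
  set κ : ℕ → ℝ≥0∞ := fun n => ENNReal.ofReal (B * (1 / α (2 ^ n)))
  have tsum_ne_top : ∑' n, κ n ≠ ∞ :=
    (hα.summable_one_div_comp_two_pow.mul_left B).tsum_ofReal_ne_top
  refine ⟨96 * (∑' n, κ n).toNNReal, fun R hR F G hF hG hFT hFG => ?_⟩
  set σ := weightMeasure μ u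
  set ω := weightMeasure μ v
  set N := ∫⁻ x, F x ^ 2 ∂σ + ∫⁻ x, G x ^ 2 ∂ω
  have class_le (n : ℕ) : ∑ J ∈ R with cls J = n, pairing μ σ ω F G J ≤ 96 * κ n * N := by
    refine (hR.mono (Finset.filter_subset _ _)).sum_pairing_le_of_entropyClass hu hv
      (D := 2 ^ (n + 1)) ?_ hF hG hFT fun J hJ => hFG J (Finset.mem_filter.1 hJ).1
    intro J hJ hu0 hv0
    obtain ⟨hJR, rfl⟩ := Finset.mem_filter.1 hJ
    exact hcls J (hR.subset_lattice hJR) hu0 hv0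
  calc ∑ J ∈ R, pairing μ σ ω F G J
      = ∑ n ∈ R.image cls, ∑ J ∈ R with cls J = n, pairing μ σ ω F G J :=
        (Finset.sum_fiberwise_of_maps_to (fun J hJ => Finset.mem_image_of_mem cls hJ) _).symm
    _ ≤ ∑ n ∈ R.image cls, 96 * κ n * N := Finset.sum_le_sum fun n _ => class_le n
    _ = 96 * (∑ n ∈ R.image cls, κ n) * N := by rw [← Finset.sum_mul, ← Finset.mul_sum]
    _ ≤ 96 * (∑' n, κ n) * N := by
        gcongr
        exact ENNReal.sum_le_tsum _
    _ = (96 * (∑' n, κ n).toNNReal : ℝ≥0) * N := by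
        rw [ENNReal.coe_mul, ENNReal.coe_toNNReal tsum_ne_top, ENNReal.coe_ofNat]

theorem exists_sum_pairing_le (hα : IsPenalty α)
    (hu : ∀ I ∈ 𝓕.lattice, ∫⁻ x in I, (u x : ℝ≥0∞) ∂μ < ∞)
    (hv : ∀ I ∈ 𝓕.lattice, ∫⁻ x in I, (v x : ℝ≥0∞) ∂μ < ∞)
    (huv : 𝓕.OneSidedBump α u v) (hvu : 𝓕.OneSidedBump α v u) :
    ∃ C : ℝ≥0, ∀ R : Finset (Set X), 𝓕.IsSparse (R : Set (Set X)) → ∀ F G : X → ℝ≥0∞,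
      AEMeasurable F (weightMeasure μ u) → AEMeasurable G (weightMeasure μ v) →
      ∫⁻ x, F x ^ 2 ∂(weightMeasure μ u) ≠ ∞ → ∫⁻ x, G x ^ 2 ∂(weightMeasure μ v) ≠ ∞ →
      ∑ J ∈ R, pairing μ (weightMeasure μ u) (weightMeasure μ v) F G J ≤
        C * (∫⁻ x, F x ^ 2 ∂(weightMeasure μ u) + ∫⁻ x, G x ^ 2 ∂(weightMeasure μ v)) := by
  classical
  obtain ⟨C₁, hC₁⟩ := huv.exists_sum_pairing_le hα hu hv
  obtain ⟨C₂, hC₂⟩ := hvu.exists_sum_pairing_le hα hv hu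
  refine ⟨C₁ + C₂, fun R hR F G hF hG hFT hGT => ?_⟩
  set σ := weightMeasure μ u
  set ω := weightMeasure μ v
  set F_dominates : Set X → Prop := fun J =>
    (⨍⁻ x in J, G x ∂ω) ^ 2 * ω J ≤ (⨍⁻ x in J, F x ∂σ) ^ 2 * σ J
  have F_part := hC₁ (R.filter F_dominates) (hR.mono (Finset.filter_subset _ _)) F G hF hG hFT
    fun J hJ => (Finset.mem_filter.1 hJ).2
  have G_part := hC₂ (R.filter (¬ F_dominates ·)) (hR.mono (Finset.filter_subset _ _)) G F hG hF
    hGT fun J hJ => (not_le.1 (Finset.mem_filter.1 hJ).2).le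
  calc ∑ J ∈ R, pairing μ σ ω F G J
      = ∑ J ∈ R with F_dominates J, pairing μ σ ω F G J +
          ∑ J ∈ R with ¬ F_dominates J, pairing μ ω σ G F J := by
        simp only [pairing_comm (σ := ω)]
        exact (Finset.sum_filter_add_sum_filter_not _ _ _).symm
    _ ≤ C₁ * (∫⁻ x, F x ^ 2 ∂σ + ∫⁻ x, G x ^ 2 ∂ω) +
          C₂ * (∫⁻ x, G x ^ 2 ∂ω + ∫⁻ x, F x ^ 2 ∂σ) := add_le_add F_part G_part
    _ = (C₁ + C₂ : ℝ≥0) * (∫⁻ x, F x ^ 2 ∂σ + ∫⁻ x, G x ^ 2 ∂ω) := by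
        push_cast
        ring

end AtomicFiltration

end BilinearForm

section SparseOperator

variable {X : Type*} [MeasurableSpace X] {μ ν : Measure X}

lemma lintegral_sq_tsum_le_of_forall_finset {ι : Type*} [Countable ι] {t : ι → X → ℝ≥0∞}
    (ht : ∀ i, Measurable (t i)) {c : ℝ≥0∞}
    (h : ∀ s : Finset ι, ∫⁻ x, (∑ i ∈ s, t i x) ^ 2 ∂ν ≤ c) :
    ∫⁻ x, (∑' i, t i x) ^ 2 ∂ν ≤ c := by
  calc ∫⁻ x, (∑' i, t i x) ^ 2 ∂ν = ∫⁻ x, ⨆ s : Finset ι, (∑ i ∈ s, t i x) ^ 2 ∂ν := by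
        simp_rw [ENNReal.tsum_eq_iSup_sum, ENNReal.iSup_pow]
    _ = ⨆ s : Finset ι, ∫⁻ x, (∑ i ∈ s, t i x) ^ 2 ∂ν :=
        lintegral_iSup_directed_of_measurable
          (fun s => (Finset.measurable_sum _ fun i _ => ht i).pow_const 2)
          (directed_of_isDirected_le fun s s' hss' x =>
            pow_le_pow_left' (Finset.sum_le_sum_of_subset hss') 2)
    _ ≤ c := iSup_le h

/-- The term `(∫_J F dν / |J|) 𝟏_J` of a sparse operator applied to the measure `F dν`; for
`ν = u dx` and `F = |f|` it dominates the term of `T(fu)`. -/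
noncomputable def lsparseTerm (μ ν : Measure X) (F : X → ℝ≥0∞) (J : Set X) : X → ℝ≥0∞ :=
  J.indicator fun _ => (∫⁻ x in J, F x ∂ν) / μ J

/-- The sparse operator `∑_{J ∈ Q} (∫_J F dν / |J|) 𝟏_J` applied to the measure `F dν`. -/
noncomputable def lsparseOp (μ ν : Measure X) (Q : Set (Set X)) (F : X → ℝ≥0∞) (x : X) : ℝ≥0∞ :=
  ∑' J : Q, lsparseTerm μ ν F J x

namespace AtomicFiltration

variable {𝓕 : AtomicFiltration μ} {α : ℝ → ℝ} {u v : X → ℝ≥0} {F : X → ℝ≥0∞}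

lemma measurable_lsparseTerm {J : Set X} (hJ : J ∈ 𝓕.lattice) : Measurable (lsparseTerm μ ν F J) :=
  measurable_const.indicator (measurableSet_of_mem_lattice hJ)

lemma IsSparse.countable {Q : Set (Set X)} (hQ : 𝓕.IsSparse Q) : Countable Q :=
  (𝓕.countable_lattice.mono hQ.subset_lattice).to_subtype

lemma IsSparse.measurable_lsparseOp {Q : Set (Set X)} (hQ : 𝓕.IsSparse Q) :
    Measurable (lsparseOp μ ν Q F) :=
  have := hQ.countable
  Measurable.tsum fun J => measurable_lsparseTerm (hQ.subset_lattice J.2)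

lemma lintegral_sq_sum_lsparseTerm_ne_top {ω : Measure X} {R : Finset (Set X)}
    (hR : ∀ J ∈ R, J ∈ 𝓕.lattice) (hω : ∀ J ∈ R, ω J ≠ ∞)
    (hF : ∀ J ∈ R, ∫⁻ x in J, F x ∂ν ≠ ∞) :
    ∫⁻ x, (∑ J ∈ R, lsparseTerm μ ν F J x) ^ 2 ∂ω ≠ ∞ := by
  have coeff_ne_top : ∀ J ∈ R, (∫⁻ x in J, F x ∂ν) / μ J ≠ ∞ := fun J hJ =>
    ENNReal.div_ne_top (hF J hJ) (measure_ne_zero_of_mem_lattice (hR J hJ))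
  classical
  refine ne_top_of_le_ne_top ?_ ((𝓕.isLaminar_lattice.mono hR).lintegral_sq_sum_indicator_le
    (fun J hJ => measurableSet_of_mem_lattice (hR J hJ)) (fun J => (∫⁻ x in J, F x ∂ν) / μ J) ω)
  refine ENNReal.mul_ne_top ENNReal.ofNat_ne_top (ENNReal.sum_ne_top.2 fun J hJ =>
    ENNReal.mul_ne_top (coeff_ne_top J hJ) (ENNReal.sum_ne_top.2 fun K hK => ?_))
  have hKR := (Finset.mem_filter.1 hK).1
  exact ENNReal.mul_ne_top (coeff_ne_top K hKR) (hω K hKR)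

lemma sum_pairing_lsparseTerm {ω : Measure X} {R : Finset (Set X)}
    (hR : ∀ J ∈ R, J ∈ 𝓕.lattice) (s : ℝ≥0∞) :
    ∑ J ∈ R, pairing μ ν ω F (fun x => s * ∑ K ∈ R, lsparseTerm μ ν F K x) J =
      s * ∫⁻ x, (∑ J ∈ R, lsparseTerm μ ν F J x) ^ 2 ∂ω := by
  have hm : ∀ J ∈ R, MeasurableSet J := fun J hJ => measurableSet_of_mem_lattice (hR J hJ)
  have meas : Measurable fun x => ∑ J ∈ R, lsparseTerm μ ν F J x := measurable_sum_indicator hm _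
  simp_rw [sq, pairing, lintegral_const_mul s meas]
  unfold lsparseTerm at meas ⊢
  rw [lintegral_sum_indicator_mul hm _ meas.aemeasurable, Finset.mul_sum]
  exact Finset.sum_congr rfl fun J _ => by ring

theorem exists_lintegral_sq_sum_lsparseTerm_le (hα : IsPenalty α)
    (hu : ∀ I ∈ 𝓕.lattice, ∫⁻ x in I, (u x : ℝ≥0∞) ∂μ < ∞)
    (hv : ∀ I ∈ 𝓕.lattice, ∫⁻ x in I, (v x : ℝ≥0∞) ∂μ < ∞)
    (huv : 𝓕.OneSidedBump α u v) (hvu : 𝓕.OneSidedBump α v u) :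
    ∃ C : ℝ≥0, ∀ R : Finset (Set X), 𝓕.IsSparse (R : Set (Set X)) → ∀ F : X → ℝ≥0∞,
      AEMeasurable F (weightMeasure μ u) → ∫⁻ x, F x ^ 2 ∂(weightMeasure μ u) ≠ ∞ →
      ∫⁻ x, (∑ J ∈ R, lsparseTerm μ (weightMeasure μ u) F J x) ^ 2 ∂(weightMeasure μ v) ≤
        C * ∫⁻ x, F x ^ 2 ∂(weightMeasure μ u) := by
  obtain ⟨C, hC⟩ := exists_sum_pairing_le hα hu hv huv hvu
  refine ⟨4 * C ^ 2, fun R hR F hF hFT => ?_⟩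
  set σ := weightMeasure μ u
  set ω := weightMeasure μ v
  have hlat : ∀ J ∈ R, J ∈ 𝓕.lattice := fun J hJ => hR.subset_lattice hJ
  set h : X → ℝ≥0∞ := fun x => ∑ J ∈ R, lsparseTerm μ σ F J x
  have h_meas : Measurable h :=
    Finset.measurable_sum _ fun J hJ => measurable_lsparseTerm (hlat J hJ)
  have h_ne_top : ∫⁻ x, h x ^ 2 ∂ω ≠ ∞ := lintegral_sq_sum_lsparseTerm_ne_top hlat
    (fun J hJ => weightMeasure_ne_top (hlat J hJ) (hv J (hlat J hJ)))
    fun J hJ => setLIntegral_ne_top_of_lintegral_sq_ne_top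
      (weightMeasure_ne_top (hlat J hJ) (hu J (hlat J hJ))) hFT
  have lintegral_sq_mul (s : ℝ≥0) : ∫⁻ x, (s * h x) ^ 2 ∂ω = s ^ 2 * ∫⁻ x, h x ^ 2 ∂ω := by
    simp_rw [mul_pow]
    exact lintegral_const_mul _ (h_meas.pow_const 2)
  push_cast
  refine le_four_mul_sq_mul_of_forall_mul_le h_ne_top fun s => ?_
  rw [← sum_pairing_lsparseTerm hlat, ← lintegral_sq_mul]
  refine hC R hR F (fun x => s * h x) hF (h_meas.const_mul _).aemeasurable hFT ?_
  rw [lintegral_sq_mul]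
  finiteness

theorem exists_lintegral_sq_lsparseOp_le (hα : IsPenalty α)
    (hu : ∀ I ∈ 𝓕.lattice, ∫⁻ x in I, (u x : ℝ≥0∞) ∂μ < ∞)
    (hv : ∀ I ∈ 𝓕.lattice, ∫⁻ x in I, (v x : ℝ≥0∞) ∂μ < ∞)
    (huv : 𝓕.OneSidedBump α u v) (hvu : 𝓕.OneSidedBump α v u) :
    ∃ C : ℝ≥0, ∀ Q : Set (Set X), 𝓕.IsSparse Q → ∀ F : X → ℝ≥0∞,
      AEMeasurable F (weightMeasure μ u) → ∫⁻ x, F x ^ 2 ∂(weightMeasure μ u) ≠ ∞ →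
      ∫⁻ x, lsparseOp μ (weightMeasure μ u) Q F x ^ 2 ∂(weightMeasure μ v) ≤
        C * ∫⁻ x, F x ^ 2 ∂(weightMeasure μ u) := by
  obtain ⟨C, hC⟩ := exists_lintegral_sq_sum_lsparseTerm_le hα hu hv huv hvu
  refine ⟨C, fun Q hQ F hF hFT => ?_⟩
  have := hQ.countable
  refine lintegral_sq_tsum_le_of_forall_finset
    (fun J => measurable_lsparseTerm (hQ.subset_lattice J.2)) fun s => ?_
  have map_subset : ∀ J ∈ s.map (Function.Embedding.subtype (· ∈ Q)), J ∈ Q := by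
    simp +contextual
  simpa only [Finset.sum_map, Function.Embedding.subtype_apply] using
    hC (s.map (Function.Embedding.subtype _)) (hQ.mono map_subset) F hF hFT

variable {𝕜 : Type*} [RCLike 𝕜] {f : X → 𝕜}

lemma enorm_sparseTerm_mul_le (hu : Measurable u) {J : Set X} (hJ : J ∈ 𝓕.lattice) (x : X) :
    ‖sparseTerm μ (fun y => f y * ((u y : ℝ) : 𝕜)) J x‖ₑ ≤
      lsparseTerm μ (weightMeasure μ u) (fun y => ‖f y‖ₑ) J x := by
  by_cases hx : x ∈ J
  · have enorm_weight (y : X) : ‖((u y : ℝ) : 𝕜)‖ₑ = u y := by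
      rw [← ofReal_norm, RCLike.norm_ofReal, abs_of_nonneg (NNReal.coe_nonneg _),
        ENNReal.ofReal_coe_nnreal]
    rw [sparseTerm, lsparseTerm, Set.indicator_of_mem hx, Set.indicator_of_mem hx]
    calc ‖⨍ y in J, f y * ((u y : ℝ) : 𝕜) ∂μ‖ₑ ≤ ⨍⁻ y in J, ‖f y * ((u y : ℝ) : 𝕜)‖ₑ ∂μ :=
          enorm_integral_le_lintegral_enorm _
      _ = (∫⁻ y in J, ‖f y‖ₑ ∂(weightMeasure μ u)) / μ J := by
          rw [setLAverage_eq, setLIntegral_withDensity_eq_setLIntegral_mul_non_measurable μ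
            hu.coe_nnreal_ennreal _ (measurableSet_of_mem_lattice hJ) (by simp)]
          simp only [enorm_mul, enorm_weight, Pi.mul_apply, mul_comm]
  · simp [sparseTerm, hx]

lemma IsSparse.enorm_sparseOp_mul_le (hu : Measurable u) {Q : Set (Set X)} (hQ : 𝓕.IsSparse Q)
    (x : X) : ‖sparseOp μ Q (fun y => f y * ((u y : ℝ) : 𝕜)) x‖ₑ ≤
      lsparseOp μ (weightMeasure μ u) Q (fun y => ‖f y‖ₑ) x :=
  enorm_tsum_le_tsum_enorm.trans <|
    ENNReal.tsum_le_tsum fun J => enorm_sparseTerm_mul_le hu (hQ.subset_lattice J.2) x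

lemma IsSparse.summable_sparseTerm_mul (hu : Measurable u) {Q : Set (Set X)} (hQ : 𝓕.IsSparse Q)
    {x : X} (hx : lsparseOp μ (weightMeasure μ u) Q (fun y => ‖f y‖ₑ) x ≠ ∞) :
    Summable fun J : Q => sparseTerm μ (fun y => f y * ((u y : ℝ) : 𝕜)) (J : Set X) x :=
  .of_nnnorm <| ENNReal.tsum_coe_ne_top_iff_summable.1 <| ne_top_of_le_ne_top hx <|
    ENNReal.tsum_le_tsum fun J => enorm_sparseTerm_mul_le hu (hQ.subset_lattice J.2) x

end AtomicFiltration

lemma lintegral_enorm_sq_ne_top {E : Type*} [NormedAddCommGroup E] {f : X → E} (hf : MemLp f 2 ν) :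
    ∫⁻ x, ‖f x‖ₑ ^ 2 ∂ν ≠ ∞ := by
  simpa using (lintegral_rpow_enorm_lt_top_of_eLpNorm_lt_top two_ne_zero ENNReal.ofNat_ne_top
    hf.2).ne

lemma lintegral_weightMeasure {w : X → ℝ≥0} (hw : Measurable w) (F : X → ℝ≥0∞) :
    ∫⁻ x, F x ∂(weightMeasure μ w) = ∫⁻ x, F x * w x ∂μ := by
  rw [lintegral_withDensity_eq_lintegral_mul_non_measurable μ hw.coe_nnreal_ennreal (by simp)]
  simp only [Pi.mul_apply, mul_comm]

end SparseOperator

end EntropyBump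

theorem mainTheorem2 {X : Type*} [MeasurableSpace X] (μ : Measure X) [SigmaFinite μ]
    (𝓕 : EntropyBump.AtomicFiltration μ) {𝕜 : Type*} [RCLike 𝕜]
    -- the penalty function
    (α : ℝ → ℝ) (hα_pos : ∀ t, 1 ≤ t → 0 < α t)
    (hα_mono : MonotoneOn (fun t => t * α t) (Ici 1))
    (hα_int : IntegrableOn (fun t => 1 / (t * α t)) (Ioi 1))
    -- the weights
    (u v : X → ℝ≥0) (hu : Measurable u) (hv : Measurable v)
    (hu_int : ∀ I ∈ 𝓕.lattice, ∫⁻ x in I, (u x : ℝ≥0∞) ∂μ < ∞)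
    (hv_int : ∀ I ∈ 𝓕.lattice, ∫⁻ x in I, (v x : ℝ≥0∞) ∂μ < ∞)
    -- the separated bump conditions
    (huv : 𝓕.OneSidedBump α u v) (hvu : 𝓕.OneSidedBump α v u) :
    ∃ C : ℝ≥0, ∀ Q : Set (Set X), 𝓕.IsSparse Q →
      ∀ f : X → 𝕜, MemLp f 2 (μ.withDensity fun x => (u x : ℝ≥0∞)) →
        -- the series that defines `T(fu)` converges absolutely `v dx`-almost everywhere
        (∀ᵐ x ∂(μ.withDensity fun x => (v x : ℝ≥0∞)),
          Summable fun I : Q =>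
            EntropyBump.sparseTerm μ (fun y => f y * ((u y : ℝ) : 𝕜)) (I : Set X) x) ∧
        ∫⁻ x, ‖EntropyBump.sparseOp μ Q (fun y => f y * ((u y : ℝ) : 𝕜)) x‖ₑ ^ 2 * v x ∂μ
          ≤ C * ∫⁻ x, ‖f x‖ₑ ^ 2 * u x ∂μ := by
  obtain ⟨C, hC⟩ := EntropyBump.AtomicFiltration.exists_lintegral_sq_lsparseOp_le
    ⟨hα_pos, hα_mono, hα_int⟩ hu_int hv_int huv hvu
  refine ⟨C, fun Q hQ f hf => ?_⟩
  have hfT := EntropyBump.lintegral_enorm_sq_ne_top hf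
  have sq_le := hC Q hQ (fun x => ‖f x‖ₑ) hf.1.enorm hfT
  constructor
  · have ae_lt_top := ae_lt_top (hQ.measurable_lsparseOp.pow_const 2)
      (ne_top_of_le_ne_top (ENNReal.mul_ne_top ENNReal.coe_ne_top hfT) sq_le)
    filter_upwards [ae_lt_top] with x hx
    exact hQ.summable_sparseTerm_mul hu fun h => by simp [h] at hx
  · rw [← EntropyBump.lintegral_weightMeasure hu, ← EntropyBump.lintegral_weightMeasure hv]
    refine (lintegral_mono fun x => ?_).trans sq_le
    gcongr
    exact hQ.enorm_sparseOp_mul_le hu x
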